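/- Let $\mathcal H$ be a separable real Hilbert space and $(\Omega,\mathcal F,\Pr)$ a probability space. \emph{Errors.} Let $(w_j)_{j\in\mathbb Z}$ be i.i.d. $\mathcal H$-valued random elements with $E w_0=0$ and $0<E\|w_0\|^2<\infty$, and let $\varepsilon_i=\sum_{j\ge 0}h_j(w_{i-j})$ almost surely, $i\in\mathbb Z$, where $h_j$ are bounded linear operators on $\mathcal H$, $h_0$ is the identity, and $\|h_j\|<a\rho^j$ for all $j\ge 0$, for some $a>0$, $\rho\in(0,1)$. Suppose $E\exp(\iota\|\varepsilon_0\|)<\infty$ for some $\iota>0$. \emph{Model.} For each large $n$ let $m_n\ge 0$ be an integer, $0=v_0<v_1<\dots<v_{m_n}<v_{m_n+1}=n$ integers and $\mu_0,\dots,\mu_{m_n}\in\mathcal H$ (the $v_j$ and $\mu_j$ may depend on $n$). One observes $X_i=\mu_j+\varepsilon_i$ for $v_j<i\le v_{j+1}$, $0\le j\le m_n$. Suppose there are constants $\eta>0$, $B<\infty$, $c_1>0$ and $0\le\omega<1/8$, not depending on $n$, such that for all large $n$: $\|\mu_{j+1}-\mu_j\|>\eta$ for $0\le j<m_n$; $\|\mu_j\|<B$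 for $0\le j\le m_n$; and $v_{j+1}-v_j\ge c_1n^{1-\omega}$ for $0\le j\le m_n$. \emph{Procedure.} With $S_k=\sum_{j=1}^kX_j$ put, for $l<k<u$, $$\mathcal S_{l,u}^k=\sqrt{\frac{u-l}{(u-k)(k-l)}}\Bigl[S_k-S_l-\frac{k-l}{u-l}(S_u-S_l)\Bigr].$$ The procedure $\mathrm{BINSEG}(l,u,\xi)$ stops if $u-l\le 1$; otherwise it takes a maximizer $k_0$ of $\|\mathcal S_{l,u}^k\|$ over $l<k<u$ (ties broken arbitrarily); if $\|\mathcal S_{l,u}^{k_0}\|>\xi$ it adds $k_0$ to the set of estimated change points and runs $\mathrm{BINSEG}(l,k_0,\xi)$ and $\mathrm{BINSEG}(k_0,u,\xi)$; otherwise it stops. Let $\hat v_1<\dots<\hat v_{\hat m_n}$ be the estimated change points returned by $\mathrm{BINSEG}(s,n,\xi_n)$, where the starting index $s\in\{0,1\}$ is fixed. \emph{Theorem.} If for some constant $0<e<1/8-\omega$ the (deterministic) thresholds satisfy $n^{3/8+e}<\xi_n<n^{1/2-\omega-e}$ for all large $n$, then $$\Pr\bigl(\hat m_n=m_n\ \text{and}\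 |\hat v_j-v_j|\le n^{5/8+\omega}\log n\ \text{for all } 1\le j\le m_n\bigr)\to 1\qquad(n\to\infty),$$ simultaneously over all ways of breaking ties. -/

import Mathlib

open MeasureTheory ProbabilityTheory Filter Topology

noncomputable section

/-- Strong white noise in `H`: an i.i.d. two-sided sequence of random elements with mean zero and
`0 < E‖w‖² < ∞`. -/
structure IsStrongWhiteNoise {Ω H : Type*} [MeasurableSpace Ω] [NormedAddCommGroup H]
    [InnerProductSpace ℝ H] [MeasurableSpace H] (P : Measure Ω) (w : ℤ → Ω → H) : Prop where
  measurable : ∀ i, Measurable (w i)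
  indep : iIndepFun w P
  identDistrib : ∀ i, IdentDistrib (w i) (w 0) P P
  memLp_two : MemLp (w 0) 2 P
  mean_zero : ∫ x, w 0 x ∂P = 0
  variance_pos : 0 < ∫ x, ‖w 0 x‖ ^ 2 ∂P

/-- The errors `ε` are the causal linear process `ε i = ∑ j ≥ 0, h j (w (i - j))` driven by the
strong white noise `w`, with `h 0 = id` and geometrically decaying operator norms, and `‖ε 0‖` has
a finite exponential moment. -/
structure IsSubexpLinearProcess {Ω H : Type*} [MeasurableSpace Ω] [NormedAddCommGroup H]
    [InnerProductSpace ℝ H] [MeasurableSpace H] (P : Measure Ω)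
    (w : ℤ → Ω → H) (h : ℕ → H →L[ℝ] H) (ε : ℤ → Ω → H) : Prop where
  noise : IsStrongWhiteNoise P w
  measurable : ∀ i, Measurable (ε i)
  hasSum : ∀ i, ∀ᵐ x ∂P, HasSum (fun j : ℕ => h j (w (i - j) x)) (ε i x)
  coeff_zero : h 0 = ContinuousLinearMap.id ℝ H
  coeff_decay : ∃ a ρ : ℝ, 0 < a ∧ 0 < ρ ∧ ρ < 1 ∧ ∀ j, ‖h j‖ < a * ρ ^ j
  exp_moment : ∃ ι : ℝ, 0 < ι ∧ Integrable (fun x => Real.exp (ι * ‖ε 0 x‖)) P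

/-- The sample `X 1, …, X n` follows the location-error model with `m` change points
`v 1, …, v m`, where `v 0 = 0` and `v (m + 1) = n`: the mean is `μ j` on `v j < i ≤ v (j + 1)`. -/
structure IsChangePointModel {Ω H : Type*} [NormedAddCommGroup H] (n m : ℕ) (v : ℕ → ℕ)
    (μ : ℕ → H) (ε : ℤ → Ω → H) (X : ℕ → Ω → H) : Prop where
  first : v 0 = 0
  last : v (m + 1) = n
  obs : ∀ j ≤ m, ∀ i, v j < i → i ≤ v (j + 1) → ∀ x, X i x = μ j + ε i x

/-- The partial sum `X 1 + ⋯ + X k`. -/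
def partialSum {H : Type*} [NormedAddCommGroup H] (X : ℕ → H) (k : ℕ) : H :=
  ∑ j ∈ Finset.Icc 1 k, X j

/-- The functional CUSUM process on the segment from `l` to `u`, for `l < k < u`. -/
def cusum {H : Type*} [NormedAddCommGroup H] [InnerProductSpace ℝ H] (X : ℕ → H)
    (l u k : ℕ) : H :=
  √(((u : ℝ) - l) / (((u : ℝ) - k) * ((k : ℝ) - l))) •
    (partialSum X k - partialSum X l -
      (((k : ℝ) - l) / ((u : ℝ) - l)) • (partialSum X u - partialSum X l))

/-- `k` maximizes the norm of the CUSUM process over `l < k < u`. -/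
def IsCusumArgmax {H : Type*} [NormedAddCommGroup H] [InnerProductSpace ℝ H] (X : ℕ → H)
    (l u k : ℕ) : Prop :=
  l < k ∧ k < u ∧ ∀ k', l < k' → k' < u → ‖cusum X l u k'‖ ≤ ‖cusum X l u k‖

/-- `BinSeg X ξ l u V`: a run of binary segmentation with threshold `ξ` on the segment from `l` to
`u` can return the set `V` of estimated change points. Ties in the argmax may be broken
arbitrarily, so there may be several such `V`; there is always at least one. -/
inductive BinSeg {H : Type*} [NormedAddCommGroup H] [InnerProductSpace ℝ H] (X : ℕ → H)
    (ξ : ℝ) : ℕ → ℕ → Finset ℕ → Prop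
  | short (l u : ℕ) (hlu : u ≤ l + 1) : BinSeg X ξ l u ∅
  | reject (l u k : ℕ) (hlu : l + 1 < u) (hk : IsCusumArgmax X l u k)
      (hξ : ‖cusum X l u k‖ ≤ ξ) : BinSeg X ξ l u ∅
  | split (l u k : ℕ) (V₁ V₂ : Finset ℕ) (hlu : l + 1 < u) (hk : IsCusumArgmax X l u k)
      (hξ : ξ < ‖cusum X l u k‖) (h₁ : BinSeg X ξ l k V₁) (h₂ : BinSeg X ξ k u V₂) :
      BinSeg X ξ l u (insert k (V₁ ∪ V₂))

/-- Binary segmentation always returns some output. -/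
theorem BinSeg.exists_output {H : Type*} [NormedAddCommGroup H] [InnerProductSpace ℝ H]
    (X : ℕ → H) (ξ : ℝ) (l u : ℕ) : ∃ V, BinSeg X ξ l u V := by
  induction hd : u - l using Nat.strong_induction_on generalizing l u with
  | _ d ih =>
    rcases Nat.lt_or_ge (l + 1) u with hlu | hlu
    · obtain ⟨k, hk, hmax⟩ := (Finset.Ioo l u).exists_max_image (fun k => ‖cusum X l u k‖)
        ⟨l + 1, by simp [hlu]⟩
      rw [Finset.mem_Ioo] at hk
      have hk' : IsCusumArgmax X l u k :=
        ⟨hk.1, hk.2, fun k' h1 h2 => hmax k' (Finset.mem_Ioo.2 ⟨h1, h2⟩)⟩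
      rcases le_or_gt ‖cusum X l u k‖ ξ with hξ | hξ
      · exact ⟨∅, .reject l u k hlu hk' hξ⟩
      · obtain ⟨V₁, h₁⟩ := ih (k - l) (by omega) l k rfl
        obtain ⟨V₂, h₂⟩ := ih (u - k) (by omega) k u rfl
        exact ⟨_, .split l u k V₁ V₂ hlu hk' hξ h₁ h₂⟩
    · exact ⟨∅, .short l u hlu⟩

/-- The estimated set `V` has exactly `m` elements and, in increasing order, its elements are
within `f` of the true change points `v 1, …, v m`. -/
def RecoversWithin (V : Finset ℕ) (m : ℕ) (v : ℕ → ℕ) (f : ℝ) : Prop :=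
  ∃ hV : V.card = m, ∀ j : Fin m,
    |((V.orderEmbOfFin hV j : ℕ) : ℝ) - (v ((j : ℕ) + 1) : ℝ)| ≤ f

end

/-! The proof combines a deterministic recovery statement with a uniform noise bound. Split each
CUSUM into a mean part and a noise part, and suppose every noise CUSUM has norm at most λ. The
recursion keeps both endpoints of the current segment within D of true change points `v i` and `v j`
(`BinSeg.exists_matching`). If j = i + 1, the mean is constant up to D terms at each end, so its
CUSUM is O(√D) and the run stops. If j > i + 1, the tied-down mean sum has second difference of norm
at least Lη at a change, so the CUSUM maximum is at least of order Lη/√n and the run splits.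

The split is well located by `near_argmax_mul_le`. Between changes the mean CUSUM is an affine
function divided by the square root of a strictly concave quadratic, so its norm drops
quantitatively below the maximum M inside a constant stretch. The noise shifts the maximum by at
most 2λ. An argmax farther than D from all changes would give M D L ≤ 2λn², hence D L² η ≤
4λn^(5/2). This fails for D = n^(5/8+ω) log n, L of order n^(1-ω) and λ of order n^τ as soon as τ <
1/8 - ω.

For the noise, `cosh_norm_add_le` makes `cosh ‖·‖` grow by a controlled factor in mean when an
independent centered term is added. Markov's inequality then gives exponential tails for normalized
sums of innovations. The geometric decay of the `h j` and a union bound over segments and lags carry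
these tails to the linear process. -/

/-! ### Deterministic geometry of the CUSUM process. -/

section Cusum

variable {H : Type*} [NormedAddCommGroup H]

/-- The sum `X (a + 1) + ⋯ + X b`, for `a ≤ b`. -/
def segmentSum (X : ℕ → H) (a b : ℕ) : H := ∑ i ∈ Finset.Ioc a b, X i

theorem partialSum_sub_partialSum (X : ℕ → H) {a b : ℕ} (hab : a ≤ b) :
    partialSum X b - partialSum X a = segmentSum X a b := by
  unfold partialSum segmentSum
  rw [sub_eq_iff_eq_add']
  have hdisj : Disjoint (Finset.Icc 1 a) (Finset.Ioc a b) := by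
    rw [Finset.disjoint_left]
    intro i h1 h2
    simp only [Finset.mem_Icc, Finset.mem_Ioc] at h1 h2
    omega
  rw [← Finset.sum_union hdisj]
  congr 1
  ext i
  simp only [Finset.mem_union, Finset.mem_Icc, Finset.mem_Ioc]
  omega

theorem segmentSum_add (X : ℕ → H) {a b c : ℕ} (hab : a ≤ b) (hbc : b ≤ c) :
    segmentSum X a b + segmentSum X b c = segmentSum X a c := by
  rw [← partialSum_sub_partialSum X hab, ← partialSum_sub_partialSum X hbc,
    ← partialSum_sub_partialSum X (hab.trans hbc)]
  abel

theorem norm_segmentSum_le {X : ℕ → H} {C : ℝ} {a b : ℕ} (hab : a ≤ b)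
    (hX : ∀ i, a < i → i ≤ b → ‖X i‖ ≤ C) : ‖segmentSum X a b‖ ≤ ((b : ℝ) - a) * C := by
  refine (norm_sum_le_of_le (f := X) (n := fun _ => C) _
    fun i hi => hX i (Finset.mem_Ioc.1 hi).1 (Finset.mem_Ioc.1 hi).2).trans_eq ?_
  rw [Finset.sum_const, Nat.card_Ioc, nsmul_eq_mul, Nat.cast_sub hab]

variable [InnerProductSpace ℝ H]

theorem segmentSum_const {X : ℕ → H} {c : H} {a b : ℕ} (hab : a ≤ b)
    (hX : ∀ i, a < i → i ≤ b → X i = c) : segmentSum X a b = ((b : ℝ) - a) • c := by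
  unfold segmentSum
  rw [Finset.sum_congr rfl (g := fun _ => c)
    fun i hi => hX i (Finset.mem_Ioc.1 hi).1 (Finset.mem_Ioc.1 hi).2]
  rw [Finset.sum_const, Nat.card_Ioc, ← Nat.cast_smul_eq_nsmul ℝ, Nat.cast_sub hab]

/-- The unnormalized CUSUM process, i.e. the tied-down partial sum process. -/
noncomputable def tiedSum (X : ℕ → H) (l u k : ℕ) : H :=
  segmentSum X l k - (((k : ℝ) - l) / ((u : ℝ) - l)) • segmentSum X l u

/-- The normalization of the CUSUM process. -/
noncomputable def cusumScale (l u k : ℕ) : ℝ := √((((u : ℝ) - k) * ((k : ℝ) - l)) / ((u : ℝ) - l))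

theorem cusum_eq_inv_smul (X : ℕ → H) {l u k : ℕ} (hlk : l < k) (hku : k < u) :
    cusum X l u k = (cusumScale l u k)⁻¹ • tiedSum X l u k := by
  unfold cusum cusumScale tiedSum
  rw [partialSum_sub_partialSum X hlk.le, partialSum_sub_partialSum X (hlk.trans hku).le,
    ← Real.sqrt_inv, inv_div]

theorem cusumScale_pos {l u k : ℕ} (hlk : l < k) (hku : k < u) : 0 < cusumScale l u k := by
  have h1 : (l : ℝ) < k := by exact_mod_cast hlk
  have h2 : (k : ℝ) < u := by exact_mod_cast hku
  exact Real.sqrt_pos.2 (div_pos (mul_pos (by linarith) (by linarith)) (by linarith))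

theorem cusumScale_sq {l u k : ℕ} (hlk : l ≤ k) (hku : k ≤ u) :
    cusumScale l u k ^ 2 = (((u : ℝ) - k) * ((k : ℝ) - l)) / ((u : ℝ) - l) := by
  have h1 : (l : ℝ) ≤ k := by exact_mod_cast hlk
  have h2 : (k : ℝ) ≤ u := by exact_mod_cast hku
  exact Real.sq_sqrt (div_nonneg (mul_nonneg (by linarith) (by linarith)) (by linarith))

theorem cusumScale_nonneg (l u k : ℕ) : 0 ≤ cusumScale l u k := Real.sqrt_nonneg _

theorem norm_tiedSum_eq (X : ℕ → H) {l u k : ℕ} (hlk : l < k) (hku : k < u) :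
    ‖tiedSum X l u k‖ = ‖cusum X l u k‖ * cusumScale l u k := by
  have h := cusumScale_pos hlk hku
  rw [cusum_eq_inv_smul X hlk hku, norm_smul, Real.norm_of_nonneg (inv_nonneg.2 h.le)]
  field_simp

theorem tiedSum_left (X : ℕ → H) (l u : ℕ) : tiedSum X l u l = 0 := by
  simp [tiedSum, segmentSum]

theorem tiedSum_right (X : ℕ → H) {l u : ℕ} (hlu : l < u) : tiedSum X l u u = 0 := by
  have h1 : (l : ℝ) < u := by exact_mod_cast hlu
  rw [tiedSum, div_self (by linarith), one_smul, sub_self]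

/-- A uniform bound on the CUSUM process bounds the tied-down process on the closed segment. -/
theorem norm_tiedSum_le {X : ℕ → H} {l u : ℕ} {M : ℝ} (hM0 : 0 ≤ M) (hlu : l < u)
    (hM : ∀ k, l < k → k < u → ‖cusum X l u k‖ ≤ M) {k : ℕ} (hlk : l ≤ k) (hku : k ≤ u) :
    ‖tiedSum X l u k‖ ≤ M * cusumScale l u k := by
  rcases hlk.eq_or_lt with rfl | hlk
  · rw [tiedSum_left, norm_zero]; exact mul_nonneg hM0 (cusumScale_nonneg _ _ _)
  rcases hku.eq_or_lt with rfl | hku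
  · rw [tiedSum_right X hlu, norm_zero]; exact mul_nonneg hM0 (cusumScale_nonneg _ _ _)
  rw [norm_tiedSum_eq X hlk hku]
  exact mul_le_mul_of_nonneg_right (hM k hlk hku) (cusumScale_nonneg _ _ _)

/-- AM-GM for the two lengths u - k and k - l. -/
theorem cusumScale_sq_le {l u k : ℕ} (hlk : l ≤ k) (hku : k ≤ u) (hlu : l < u) :
    cusumScale l u k ^ 2 ≤ ((u : ℝ) - l) / 4 := by
  have h : (l : ℝ) < u := by exact_mod_cast hlu
  rw [cusumScale_sq hlk hku, div_le_iff₀ (by linarith)]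
  nlinarith [sq_nonneg ((u : ℝ) - k - (k - l))]

theorem cusum_add (Y E : ℕ → H) (l u k : ℕ) :
    cusum (fun i => Y i + E i) l u k = cusum Y l u k + cusum E l u k := by
  simp only [cusum, partialSum, Finset.sum_add_distrib]
  rw [← smul_add]
  congr 1
  module

/-- Shift invariance allows centering at whichever constant makes most terms, or a whole side,
vanish. -/
theorem cusum_sub_const (X : ℕ → H) (c : H) {l u k : ℕ} (hlk : l < k) (hku : k < u) :
    cusum (fun i => X i - c) l u k = cusum X l u k := by
  have h : (l : ℝ) < u := by exact_mod_cast hlk.trans hku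
  have h0 : tiedSum (fun _ => -c) l u k = 0 := by
    rw [tiedSum, segmentSum_const hlk.le (c := -c) (fun _ _ _ => rfl),
      segmentSum_const (hlk.trans hku).le (c := -c) (fun _ _ _ => rfl), smul_smul,
      div_mul_cancel₀ _ (by linarith), sub_self]
  simp only [sub_eq_add_neg]
  rw [cusum_add, cusum_eq_inv_smul (fun _ => -c) hlk hku, h0, smul_zero, add_zero]

/-- The CUSUM process is controlled by the normalized sums on both sides. -/
theorem norm_cusum_le (X : ℕ → H) {l u k : ℕ} (hlk : l < k) (hku : k < u) {a b : ℝ}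
    (ha : ‖segmentSum X l k‖ ≤ √((k : ℝ) - l) * a)
    (hb : ‖segmentSum X k u‖ ≤ √((u : ℝ) - k) * b) : ‖cusum X l u k‖ ≤ a + b := by
  have h1 : (0 : ℝ) < k - l := by have : (l : ℝ) < k := by exact_mod_cast hlk
                                  linarith
  have h2 : (0 : ℝ) < u - k := by have : (k : ℝ) < u := by exact_mod_cast hku
                                  linarith
  have hφ := cusumScale_pos hlk hku
  have hN : (0 : ℝ) < u - l := by linarith
  have hs1 := Real.sqrt_pos.2 h1
  have hs2 := Real.sqrt_pos.2 h2
  have hsN := Real.sqrt_pos.2 hN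
  have ha0 : 0 ≤ a := nonneg_of_mul_nonneg_right ((norm_nonneg _).trans ha) hs1
  have hb0 : 0 ≤ b := nonneg_of_mul_nonneg_right ((norm_nonneg _).trans hb) hs2
  have htied : tiedSum X l u k = (((u : ℝ) - k) / (u - l)) • segmentSum X l k -
      (((k : ℝ) - l) / (u - l)) • segmentSum X k u := by
    have : ((u : ℝ) - k) / (u - l) = 1 - ((k : ℝ) - l) / (u - l) := by field_simp; ring
    rw [tiedSum, ← segmentSum_add X hlk.le hku.le, this]
    module
  have hscale : cusumScale l u k = √((u : ℝ) - k) * √((k : ℝ) - l) / √((u : ℝ) - l) := by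
    rw [cusumScale, Real.sqrt_div' _ hN.le, Real.sqrt_mul h2.le]
  have hle : ‖tiedSum X l u k‖ ≤ (a + b) * cusumScale l u k := by
    have e1 : ((u : ℝ) - k) / (u - l) * (√((k : ℝ) - l) * a) ≤ a * cusumScale l u k := by
      have : ((u : ℝ) - k) / (u - l) * (√((k : ℝ) - l) * a) =
          (a * cusumScale l u k) * (√((u : ℝ) - k) / √((u : ℝ) - l)) := by
        rw [hscale]
        nth_rewrite 1 [← Real.sq_sqrt h2.le, ← Real.sq_sqrt hN.le]
        field_simp
      rw [this]
      refine mul_le_of_le_one_right (mul_nonneg ha0 hφ.le) ?_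
      rw [div_le_one hsN]
      exact Real.sqrt_le_sqrt (by linarith)
    have e2 : ((k : ℝ) - l) / (u - l) * (√((u : ℝ) - k) * b) ≤ b * cusumScale l u k := by
      have : ((k : ℝ) - l) / (u - l) * (√((u : ℝ) - k) * b) =
          (b * cusumScale l u k) * (√((k : ℝ) - l) / √((u : ℝ) - l)) := by
        rw [hscale]
        nth_rewrite 1 [← Real.sq_sqrt h1.le, ← Real.sq_sqrt hN.le]
        field_simp
      rw [this]
      refine mul_le_of_le_one_right (mul_nonneg hb0 hφ.le) ?_
      rw [div_le_one hsN]
      exact Real.sqrt_le_sqrt (by linarith)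
    rw [htied]
    refine (norm_sub_le _ _).trans ?_
    rw [norm_smul, norm_smul, Real.norm_of_nonneg (by positivity),
      Real.norm_of_nonneg (by positivity), add_mul]
    exact add_le_add ((mul_le_mul_of_nonneg_left ha (by positivity)).trans e1)
      ((mul_le_mul_of_nonneg_left hb (by positivity)).trans e2)
  rw [norm_tiedSum_eq X hlk hku] at hle
  exact le_of_mul_le_mul_right hle hφ

/-- On a stretch where `X` is constant, the tied-down process is affine. -/
theorem tiedSum_affine {X : ℕ → H} {c : H} {l u p k q : ℕ} (hlp : l ≤ p) (hpk : p ≤ k)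
    (hkq : k ≤ q) (hX : ∀ i, p < i → i ≤ q → X i = c) :
    ((q : ℝ) - p) • tiedSum X l u k =
      ((q : ℝ) - k) • tiedSum X l u p + ((k : ℝ) - p) • tiedSum X l u q := by
  unfold tiedSum
  have h1 : segmentSum X l k = segmentSum X l p + ((k : ℝ) - p) • c := by
    rw [← segmentSum_add X hlp hpk, segmentSum_const hpk fun i h h' => hX i h (h'.trans hkq)]
  have h2 : segmentSum X l q = segmentSum X l p + ((q : ℝ) - p) • c := by
    rw [← segmentSum_add X hlp (hpk.trans hkq), segmentSum_const (hpk.trans hkq) hX]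
  rw [h1, h2]
  simp only [div_eq_mul_inv]
  module

/-- A jump in the middle of two long constant stretches forces the CUSUM process to be large. -/
theorem jump_le_of_cusum_le {X : ℕ → H} {c d : H} {l u p L : ℕ} {M : ℝ} (hM0 : 0 ≤ M)
    (hlp : l + L ≤ p) (hpu : p + L ≤ u) (hL : 0 < L)
    (hM : ∀ k, l < k → k < u → ‖cusum X l u k‖ ≤ M)
    (hc : ∀ i, p < i + L → i ≤ p → X i = c) (hd : ∀ i, p < i → i ≤ p + L → X i = d) :
    L * ‖d - c‖ ≤ 2 * M * √((u : ℝ) - l) := by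
  have hlu : l < u := by omega
  have hN : (0 : ℝ) < u - l := by
    have : (l : ℝ) < u := by exact_mod_cast hlu
    linarith
  have hbd : ∀ k, l ≤ k → k ≤ u → ‖tiedSum X l u k‖ ≤ M * (√((u : ℝ) - l) / 2) := by
    intro k h1 h2
    refine (norm_tiedSum_le hM0 hlu hM h1 h2).trans (mul_le_mul_of_nonneg_left ?_ hM0)
    refine le_of_sq_le_sq ?_ (by positivity)
    rw [div_pow, Real.sq_sqrt hN.le]
    exact (cusumScale_sq_le h1 h2 hlu).trans_eq (by norm_num)
  obtain ⟨q, rfl⟩ : ∃ q, p = q + L := ⟨p - L, by omega⟩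
  -- The second difference with step L removes the linear correction and keeps only the jump. Its
  -- coefficients 1, 2, 1 and the bound M√(u-l)/2 on each value give the factor 2M.
  have key : (L : ℝ) • (d - c) =
      tiedSum X l u (q + L + L) - (2 : ℝ) • tiedSum X l u (q + L) + tiedSum X l u q := by
    have h1 : segmentSum X l (q + L) = segmentSum X l q + (L : ℝ) • c := by
      rw [← segmentSum_add X (by omega) (by omega : q ≤ q + L),
        segmentSum_const (c := c) (by omega) fun i h h' => hc i (by omega) h']
      push_cast; rw [add_sub_cancel_left]
    have h2 : segmentSum X l (q + L + L) = segmentSum X l (q + L) + (L : ℝ) • d := by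
      rw [← segmentSum_add X (by omega : l ≤ q + L) (by omega : q + L ≤ q + L + L),
        segmentSum_const (c := d) (by omega) hd]
      push_cast; rw [add_sub_cancel_left]
    unfold tiedSum
    rw [h2, h1]
    push_cast
    simp only [div_eq_mul_inv]
    module
  have hn : (L : ℝ) * ‖d - c‖ = ‖(L : ℝ) • (d - c)‖ := by
    rw [norm_smul, Real.norm_of_nonneg (Nat.cast_nonneg _)]
  rw [hn, key]
  have t1 := hbd (q + L + L) (by omega) (by omega)
  have t2 := hbd (q + L) (by omega) (by omega)
  have t3 := hbd q (by omega) (by omega)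
  have := norm_add_le (tiedSum X l u (q + L + L) - (2 : ℝ) • tiedSum X l u (q + L))
    (tiedSum X l u q)
  have := norm_sub_le (tiedSum X l u (q + L + L)) ((2 : ℝ) • tiedSum X l u (q + L))
  rw [norm_smul, Real.norm_of_nonneg (by norm_num : (0 : ℝ) ≤ 2)] at this
  linarith

/-- A near-maximizer of the CUSUM process cannot be far from both ends of a stretch on which `X`
is constant. -/
theorem near_argmax_mul_le {X : ℕ → H} {c : H} {l u p k q : ℕ} {M r : ℝ} (hM0 : 0 ≤ M)
    (hlp : l ≤ p) (hpk : p < k) (hkq : k < q) (hqu : q ≤ u)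
    (hX : ∀ i, p < i → i ≤ q → X i = c) (hM : ∀ k, l < k → k < u → ‖cusum X l u k‖ ≤ M)
    (hr : 0 ≤ r) (hrM : 2 * r ≤ M) (hk : M - 2 * r ≤ ‖cusum X l u k‖) :
    M * (((k : ℝ) - p) * (q - k)) ≤ r * ((u : ℝ) - l) ^ 2 := by
  have hlu : l < u := by omega
  have hN : (0 : ℝ) < u - l := by
    have : (l : ℝ) < u := by exact_mod_cast hlu
    linarith
  have h1 : (0 : ℝ) < k - p := by
    have : (p : ℝ) < k := by exact_mod_cast hpk
    linarith
  have h2 : (0 : ℝ) < q - k := by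
    have : (k : ℝ) < q := by exact_mod_cast hkq
    linarith
  have haff := congrArg norm (tiedSum_affine (u := u) hlp hpk.le hkq.le hX)
  have hle := norm_add_le (((q : ℝ) - k) • tiedSum X l u p) (((k : ℝ) - p) • tiedSum X l u q)
  rw [← haff] at hle
  simp only [norm_smul] at hle
  rw [Real.norm_of_nonneg (by linarith : (0 : ℝ) ≤ q - p), Real.norm_of_nonneg h2.le,
    Real.norm_of_nonneg h1.le, norm_tiedSum_eq X (by omega) (by omega)] at hle
  have hp := norm_tiedSum_le hM0 hlu hM hlp (by omega : p ≤ u)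
  have hq := norm_tiedSum_le hM0 hlu hM (by omega : l ≤ q) hqu
  set fp := cusumScale l u p
  set fq := cusumScale l u q
  set fk := cusumScale l u k with hfk
  have hfk0 : 0 < fk := cusumScale_pos (by omega) (by omega)
  have hfp0 : 0 ≤ fp := cusumScale_nonneg _ _ _
  have hfq0 : 0 ≤ fq := cusumScale_nonneg _ _ _
  have sp : fp ^ 2 = _ := cusumScale_sq hlp (by omega : p ≤ u)
  have sq : fq ^ 2 = _ := cusumScale_sq (by omega : l ≤ q) hqu
  have sk : fk ^ 2 = _ := cusumScale_sq (by omega : l ≤ k) (by omega : k ≤ u)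
  -- The norm of an affine function is convex, so the value at k is at most the interpolation of the
  -- bounds at p and q.
  have hmain : ((q : ℝ) - p) * ((M - 2 * r) * fk) ≤ M * ((q - k) * fp + (k - p) * fq) := by
    have e1 : ((q : ℝ) - p) * ((M - 2 * r) * fk) ≤ (q - p) * (‖cusum X l u k‖ * fk) :=
      mul_le_mul_of_nonneg_left (mul_le_mul_of_nonneg_right hk hfk0.le) (by linarith)
    have e2 := mul_le_mul_of_nonneg_left hp h2.le
    have e3 := mul_le_mul_of_nonneg_left hq h1.le
    linarith
  have hsq := pow_le_pow_left₀ (mul_nonneg (by linarith) (mul_nonneg (by linarith) hfk0.le))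
    hmain 2
  have hjensen : ((q - k) * fp + (k - p) * fq) ^ 2 ≤
      ((q : ℝ) - p) * ((q - k) * fp ^ 2 + (k - p) * fq ^ 2) := by
    nlinarith [mul_nonneg (mul_nonneg h1.le h2.le) (sq_nonneg (fp - fq))]
  -- The squared scale is quadratic with leading coefficient -1/(u-l); its chord lies below it by
  -- exactly (k-p)(q-k)/(u-l). This gap yields the localization.
  have hinterp : ((q : ℝ) - k) * fp ^ 2 + (k - p) * fq ^ 2 =
      (q - p) * (fk ^ 2 - (k - p) * (q - k) / (u - l)) := by
    rw [sp, sq, sk]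
    field_simp
    ring
  have hqp : (0 : ℝ) < q - p := by linarith
  have hfin : (M - 2 * r) ^ 2 * fk ^ 2 ≤ M ^ 2 * (fk ^ 2 - (k - p) * (q - k) / (u - l)) := by
    have : ((q : ℝ) - p) ^ 2 * ((M - 2 * r) ^ 2 * fk ^ 2) ≤
        (q - p) ^ 2 * (M ^ 2 * (fk ^ 2 - (k - p) * (q - k) / (u - l))) := by
      calc _ = (((q : ℝ) - p) * ((M - 2 * r) * fk)) ^ 2 := by ring
        _ ≤ M ^ 2 * ((q - k) * fp + (k - p) * fq) ^ 2 := by rw [← mul_pow]; exact hsq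
        _ ≤ M ^ 2 * (((q : ℝ) - p) * ((q - k) * fp ^ 2 + (k - p) * fq ^ 2)) :=
          mul_le_mul_of_nonneg_left hjensen (sq_nonneg _)
        _ = _ := by rw [hinterp]; ring
    exact le_of_mul_le_mul_left this (by positivity)
  have hfk4 : fk ^ 2 ≤ ((u : ℝ) - l) / 4 := cusumScale_sq_le (by omega) (by omega) hlu
  rcases hM0.eq_or_lt with rfl | hMpos
  · rw [zero_mul]; positivity
  have hd : M ^ 2 * ((k - p) * (q - k) / (u - l)) ≤ M * (r * (u - l)) := by
    have : 4 * r * M * fk ^ 2 ≤ 4 * r * M * (((u : ℝ) - l) / 4) :=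
      mul_le_mul_of_nonneg_left hfk4 (by positivity)
    have hexp : (M - 2 * r) ^ 2 * fk ^ 2 =
        M ^ 2 * fk ^ 2 - 4 * r * M * fk ^ 2 + 4 * (r ^ 2 * fk ^ 2) := by ring
    have hrf : 0 ≤ r ^ 2 * fk ^ 2 := by positivity
    rw [mul_sub] at hfin
    linarith
  have hd' : M * ((k - p) * (q - k) / (u - l)) ≤ r * ((u : ℝ) - l) := by
    refine le_of_mul_le_mul_left ?_ hMpos
    linarith [hd, show M * (M * (((k : ℝ) - p) * (q - k) / (u - l))) =
      M ^ 2 * ((k - p) * (q - k) / (u - l)) by ring]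
  rw [← mul_div_assoc, div_le_iff₀ hN] at hd'
  linarith [hd', show r * ((u : ℝ) - l) * (u - l) = r * ((u : ℝ) - l) ^ 2 by ring]

end Cusum

/-! ### Deterministic recovery when the noise is small. -/

section Recovery

variable {H : Type*} [NormedAddCommGroup H]

/-- A sum over a segment in which all but `r` of the terms vanish. -/
theorem norm_segmentSum_le_sqrt {Z : ℕ → H} {C r : ℝ} {a b : ℕ} (hab : a < b) (hC : 0 ≤ C)
    (hr : 0 ≤ r) (p q : ℕ) (hpr : (p : ℝ) ≤ a + r) (hqr : (b : ℝ) ≤ q + r)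
    (hZ : ∀ i, a < i → i ≤ b → ‖Z i‖ ≤ C) (hZ0 : ∀ i, p < i → i ≤ q → Z i = 0) :
    ‖segmentSum Z a b‖ ≤ √((b : ℝ) - a) * (C * √(2 * r)) := by
  have h1 : (0 : ℝ) < b - a := by
    have : (a : ℝ) < b := by exact_mod_cast hab
    linarith
  have hbound1 := norm_segmentSum_le hab.le hZ
  have hbound2 : ‖segmentSum Z a b‖ ≤ 2 * r * C := by
    have hsub : segmentSum Z a b =
        ∑ i ∈ (Finset.Ioc a b).filter (fun i => ¬ (p < i ∧ i ≤ q)), Z i := by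
      unfold segmentSum
      rw [Finset.sum_filter]
      refine Finset.sum_congr rfl fun i _ => ?_
      split_ifs with h
      · exact hZ0 i h.1 h.2
      · rfl
    rw [hsub]
    refine (norm_sum_le_of_le (n := fun _ => C) _ fun i hi => ?_).trans ?_
    · rw [Finset.mem_filter, Finset.mem_Ioc] at hi
      exact hZ i hi.1.1 hi.1.2
    rw [Finset.sum_const, nsmul_eq_mul]
    refine mul_le_mul_of_nonneg_right ?_ hC
    have hcard : ((Finset.Ioc a b).filter (fun i => ¬ (p < i ∧ i ≤ q))).card ≤
        (p - a) + (b - q) := by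
      rw [← Nat.card_Ioc a p, ← Nat.card_Ioc q b]
      refine (Finset.card_le_card fun i hi => ?_).trans (Finset.card_union_le _ _)
      simp only [Finset.mem_filter, Finset.mem_Ioc, Finset.mem_union] at hi ⊢
      omega
    have e1 : ((p - a : ℕ) : ℝ) ≤ r := by
      rcases le_total a p with h | h
      · rw [Nat.cast_sub h]; linarith
      · rw [Nat.sub_eq_zero_of_le h]; simpa using hr
    have e2 : ((b - q : ℕ) : ℝ) ≤ r := by
      rcases le_total q b with h | h
      · rw [Nat.cast_sub h]; linarith
      · rw [Nat.sub_eq_zero_of_le h]; simpa using hr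
    have : ((((Finset.Ioc a b).filter (fun i => ¬ (p < i ∧ i ≤ q))).card : ℕ) : ℝ) ≤
        ((p - a : ℕ) : ℝ) + ((b - q : ℕ) : ℝ) := by exact_mod_cast hcard
    linarith
  -- The geometric mean of the two bounds (b-a)C and 2rC.
  refine le_of_sq_le_sq ?_ (by positivity)
  rw [mul_pow, mul_pow, Real.sq_sqrt h1.le, Real.sq_sqrt (by positivity), sq]
  refine (mul_le_mul hbound1 hbound2 (norm_nonneg _) (by positivity)).trans_eq (by ring)

variable [InnerProductSpace ℝ H]

/-- Close to the ends of the segment the CUSUM process of a bounded sequence is small. -/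
theorem norm_cusum_le_of_near_left {Y : ℕ → H} {B : ℝ} {l u k : ℕ} (hlk : l < k) (hku : k < u)
    (hB : ∀ i, l < i → i ≤ u → ‖Y i‖ ≤ B) : ‖cusum Y l u k‖ ≤ 2 * B * √((k : ℝ) - l) := by
  have h1 : (0 : ℝ) < k - l := by
    have : (l : ℝ) < k := by exact_mod_cast hlk
    linarith
  have h2 : (0 : ℝ) < u - k := by
    have : (k : ℝ) < u := by exact_mod_cast hku
    linarith
  -- Centering at the mean over the long side makes that side's sum vanish, leaving only the k - l
  -- terms of the short side.
  set c : H := ((u : ℝ) - k)⁻¹ • segmentSum Y k u with hc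
  have hcB : ‖c‖ ≤ B := by
    rw [hc, norm_smul, Real.norm_of_nonneg (inv_nonneg.2 h2.le), inv_mul_le_iff₀ h2]
    exact norm_segmentSum_le hku.le fun i h h' => hB i (hlk.trans h) h'
  rw [← cusum_sub_const Y c hlk hku]
  have := norm_cusum_le (fun i => Y i - c) hlk hku (a := 2 * B * √((k : ℝ) - l)) (b := 0) ?_ ?_
  · simpa using this
  · refine (norm_segmentSum_le (C := 2 * B) hlk.le fun i h h' => ?_).trans_eq ?_
    · have := norm_sub_le (Y i) c
      have := hB i h (h'.trans hku.le)
      linarith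
    · linear_combination (-2 * B) * Real.mul_self_sqrt h1.le
  · have : segmentSum (fun i => Y i - c) k u = 0 := by
      unfold segmentSum
      rw [Finset.sum_sub_distrib, Finset.sum_const, Nat.card_Ioc, ← Nat.cast_smul_eq_nsmul ℝ,
        Nat.cast_sub hku.le, hc, smul_smul, mul_inv_cancel₀ h2.ne', one_smul, segmentSum, sub_self]
    simp [this]

theorem norm_cusum_le_of_near_right {Y : ℕ → H} {B : ℝ} {l u k : ℕ} (hlk : l < k) (hku : k < u)
    (hB : ∀ i, l < i → i ≤ u → ‖Y i‖ ≤ B) : ‖cusum Y l u k‖ ≤ 2 * B * √((u : ℝ) - k) := by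
  have h1 : (0 : ℝ) < k - l := by
    have : (l : ℝ) < k := by exact_mod_cast hlk
    linarith
  have h2 : (0 : ℝ) < u - k := by
    have : (k : ℝ) < u := by exact_mod_cast hku
    linarith
  set c : H := ((k : ℝ) - l)⁻¹ • segmentSum Y l k with hc
  have hcB : ‖c‖ ≤ B := by
    rw [hc, norm_smul, Real.norm_of_nonneg (inv_nonneg.2 h1.le), inv_mul_le_iff₀ h1]
    exact norm_segmentSum_le hlk.le fun i h h' => hB i h (h'.trans hku.le)
  rw [← cusum_sub_const Y c hlk hku]
  have := norm_cusum_le (fun i => Y i - c) hlk hku (a := 0) (b := 2 * B * √((u : ℝ) - k)) ?_ ?_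
  · simpa using this
  · have : segmentSum (fun i => Y i - c) l k = 0 := by
      unfold segmentSum
      rw [Finset.sum_sub_distrib, Finset.sum_const, Nat.card_Ioc, ← Nat.cast_smul_eq_nsmul ℝ,
        Nat.cast_sub hlk.le, hc, smul_smul, mul_inv_cancel₀ h1.ne', one_smul, segmentSum, sub_self]
    simp [this]
  · refine (norm_segmentSum_le (C := 2 * B) hku.le fun i h h' => ?_).trans_eq ?_
    · have := norm_sub_le (Y i) c
      have := hB i (hlk.trans h) h'
      linarith
    · linear_combination (-2 * B) * Real.mul_self_sqrt h2.le

variable {n m : ℕ} {v : ℕ → ℕ} {μ : ℕ → H} {Y E : ℕ → H} {L : ℕ} {B D lam ξ η : ℝ}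

theorem changePoint_mono (hv : ∀ j ≤ m, v j + 2 * L ≤ v (j + 1)) {a b : ℕ} (hab : a ≤ b)
    (hb : b ≤ m + 1) : v a + 2 * (L * (b - a)) ≤ v b := by
  induction b, hab using Nat.le_induction with
  | base => simp
  | succ b hab ih =>
    have h1 := hv b (by omega)
    have h2 := ih (by omega)
    rw [Nat.succ_sub hab, Nat.mul_succ]
    omega

theorem changePoint_le (hv : ∀ j ≤ m, v j + 2 * L ≤ v (j + 1)) {a b : ℕ} (hab : a ≤ b)
    (hb : b ≤ m + 1) : v a ≤ v b :=
  (Nat.le_add_right _ _).trans (changePoint_mono hv hab hb)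

theorem lt_of_changePoint_lt (hv : ∀ j ≤ m, v j + 2 * L ≤ v (j + 1)) {a b : ℕ}
    (ha : a ≤ m + 1) (hab : v a < v b) : a < b := by
  by_contra! h
  exact absurd (changePoint_le hv h ha) (by omega)

/-- Every observation index lies in one of the constant stretches. -/
theorem exists_stretch (h0 : v 0 = 0) (hlast : v (m + 1) = n) {k : ℕ} (hk : 0 < k)
    (hkn : k ≤ n) : ∃ t ≤ m, v t < k ∧ k ≤ v (t + 1) := by
  have hex : ∃ t, k ≤ v (t + 1) := ⟨m, by omega⟩
  classical
  refine ⟨Nat.find hex, Nat.find_min' hex (by omega), ?_, Nat.find_spec hex⟩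
  rcases Nat.eq_zero_or_pos (Nat.find hex) with h | h
  · rw [h]; omega
  · have := Nat.find_min hex (m := Nat.find hex - 1) (by omega)
    rw [Nat.sub_add_cancel h] at this
    omega

/-- If the segment contains no true change point in its interior, up to an error `D` at both ends,
then the CUSUM process of the means is small. -/
theorem norm_cusum_le_of_no_change
    (hv : ∀ j ≤ m, v j + 2 * L ≤ v (j + 1)) (hY : ∀ j ≤ m, ∀ i, v j < i → i ≤ v (j + 1) → Y i = μ j)
    (hB : ∀ i, 0 < i → i ≤ n → ‖Y i‖ ≤ B) (hμB : ∀ j ≤ m, ‖μ j‖ ≤ B) (hD : 0 ≤ D)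
    {i l u k : ℕ} (hi : i ≤ m) (hl : |(l : ℝ) - v i| ≤ D) (hu : |(u : ℝ) - v (i + 1)| ≤ D)
    (hun : u ≤ n) (hlk : l < k) (hku : k < u) : ‖cusum Y l u k‖ ≤ 4 * B * √(2 * D) := by
  rw [← cusum_sub_const Y (μ i) hlk hku]
  rw [abs_le] at hl hu
  have hB0 : 0 ≤ B := (norm_nonneg _).trans (hμB i hi)
  have hZ : ∀ t, l < t → t ≤ u → ‖Y t - μ i‖ ≤ 2 * B := fun t h h' => by
    have := norm_sub_le (Y t) (μ i)
    have := hB t (by omega) (by omega)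
    have := hμB i hi
    linarith
  have hZ0 : ∀ t, v i < t → t ≤ v (i + 1) → Y t - μ i = 0 := fun t h h' => by
    rw [hY i hi t h h', sub_self]
  have hvi := hv i hi
  have hlk' : (l : ℝ) ≤ k := by exact_mod_cast hlk.le
  have hku' : (k : ℝ) ≤ u := by exact_mod_cast hku.le
  refine (norm_cusum_le (fun t => Y t - μ i) hlk hku
    (norm_segmentSum_le_sqrt hlk (by positivity : 0 ≤ 2 * B) hD (v i) (v (i + 1))
      (by linarith) (by linarith) (fun t h h' => hZ t h (by omega)) hZ0)
    (norm_segmentSum_le_sqrt hku (by positivity : 0 ≤ 2 * B) hD (v i) (v (i + 1))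
      (by linarith) (by linarith) (fun t h h' => hZ t (by omega) h') hZ0)).trans_eq ?_
  ring

/-- If the segment has a true change point well inside, then the argmax of the CUSUM process exceeds
the threshold and is close to such a change point. -/
theorem argmax_near_change (h0 : v 0 = 0) (hlast : v (m + 1) = n)
    (hv : ∀ j ≤ m, v j + 2 * L ≤ v (j + 1))
    (hY : ∀ j ≤ m, ∀ i, v j < i → i ≤ v (j + 1) → Y i = μ j)
    (hB : ∀ i, 0 < i → i ≤ n → ‖Y i‖ ≤ B) (hB0 : 0 ≤ B) (hlam : 0 ≤ lam)
    (hE : ∀ l k u, l < k → k < u → u ≤ n → ‖cusum E l u k‖ ≤ lam)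
    (hjump : ∀ j < m, η ≤ ‖μ (j + 1) - μ j‖)
    (hD : 1 ≤ D) (hDL : 2 * D ≤ L)
    (hξ : 4 * B * √(2 * D) + lam ≤ ξ) (hbig : 2 * (ξ + 3 * lam) * √n < L * η)
    (hloc : 4 * lam * (n : ℝ) ^ 2 * √n < D * L ^ 2 * η)
    {i j l u k : ℕ} (hij : i + 1 < j) (hj : j ≤ m + 1) (hl : |(l : ℝ) - v i| ≤ D)
    (hu : |(u : ℝ) - v j| ≤ D) (hun : u ≤ n)
    (hk : IsCusumArgmax (fun i => Y i + E i) l u k) :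
    ξ < ‖cusum (fun i => Y i + E i) l u k‖ ∧ ∃ t, i < t ∧ t < j ∧ |(k : ℝ) - v t| ≤ D := by
  obtain ⟨hlk, hku, hmax⟩ := hk
  rw [abs_le] at hl hu
  have hLpos : 0 < L := by
    have : (0 : ℝ) < L := by linarith
    exact_mod_cast this
  have hlk' : (l : ℝ) < k := by exact_mod_cast hlk
  have hku' : (k : ℝ) < u := by exact_mod_cast hku
  have hun' : (u : ℝ) ≤ n := by exact_mod_cast hun
  have hl0 : (0 : ℝ) ≤ l := Nat.cast_nonneg _
  -- Since k maximizes the noisy CUSUM, passing to the noise-free one costs `lam` at k and `lam` at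
  -- the competitor, so M bounds the noise-free CUSUM everywhere.
  set M := ‖cusum Y l u k‖ + 2 * lam with hMdef
  have hM0 : 0 ≤ M := by positivity
  have hXle : ∀ k', l < k' → k' < u →
      ‖cusum (fun i => Y i + E i) l u k'‖ ≤ ‖cusum Y l u k'‖ + lam := fun k' h h' => by
    rw [cusum_add]
    exact (norm_add_le _ _).trans (add_le_add_right (hE l k' u h h' hun) _)
  have hYle : ∀ k', l < k' → k' < u →
      ‖cusum Y l u k'‖ ≤ ‖cusum (fun i => Y i + E i) l u k'‖ + lam := fun k' h h' => by
    rw [cusum_add]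
    have := norm_sub_le (cusum Y l u k' + cusum E l u k') (cusum E l u k')
    rw [add_sub_cancel_right] at this
    exact this.trans (add_le_add_right (hE l k' u h h' hun) _)
  have hM : ∀ k', l < k' → k' < u → ‖cusum Y l u k'‖ ≤ M := fun k' h h' => by
    have := hYle k' h h'
    have := hmax k' h h'
    have := hXle k hlk hku
    linarith
  have hvi1 := hv i (by omega)
  have hvi2 := hv (i + 1) (by omega)
  have hvj := changePoint_le hv (show i + 2 ≤ j by omega) hj
  have hvi1' : (v i : ℝ) + 2 * L ≤ v (i + 1) := by exact_mod_cast hvi1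
  have hvi2' : (v (i + 1) : ℝ) + 2 * L ≤ v j := by exact_mod_cast hvi2.trans hvj
  have hMlow : L * η ≤ 2 * M * √n := by
    have e1 : l + L ≤ v (i + 1) := by
      have : (l : ℝ) + L ≤ v (i + 1) := by linarith
      exact_mod_cast this
    have e2 : v (i + 1) + L ≤ u := by
      have : (v (i + 1) : ℝ) + L ≤ u := by linarith
      exact_mod_cast this
    have := jump_le_of_cusum_le (c := μ i) (d := μ (i + 1)) hM0 e1 e2 hLpos hM
      (fun t h h' => hY i (by omega) t (by omega) h')
      (fun t h h' => hY (i + 1) (by omega) t h (by omega))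
    have h3 : 2 * M * √((u : ℝ) - l) ≤ 2 * M * √n :=
      mul_le_mul_of_nonneg_left (Real.sqrt_le_sqrt (by linarith)) (by positivity)
    have h4 := mul_le_mul_of_nonneg_left (hjump i (by omega)) (Nat.cast_nonneg L : (0 : ℝ) ≤ L)
    linarith
  have hnpos : (0 : ℝ) < √n := Real.sqrt_pos.2 (by linarith)
  have hMξ : ξ + 3 * lam < M := by
    have : 2 * (ξ + 3 * lam) * √n < 2 * M * √n := hbig.trans_le hMlow
    have := lt_of_mul_lt_mul_right this hnpos.le
    linarith
  refine ⟨by have := hYle k hlk hku; linarith, ?_⟩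
  have hBseg : ∀ i, l < i → i ≤ u → ‖Y i‖ ≤ B := fun i h h' => hB i (by omega) (by omega)
  have hBD : 0 ≤ B * √(2 * D) := by positivity
  -- Near an end the mean CUSUM would stay below `ξ`. The distance 2D absorbs the endpoint error D,
  -- so the change found is neither `v i` nor `v j`.
  have hfar1 : 2 * D < k - l := by
    by_contra! h
    have h1 := norm_cusum_le_of_near_left hlk hku hBseg
    have h2 : 2 * B * √((k : ℝ) - l) ≤ 2 * B * √(2 * D) :=
      mul_le_mul_of_nonneg_left (Real.sqrt_le_sqrt h) (by positivity)
    linarith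
  have hfar2 : 2 * D < u - k := by
    by_contra! h
    have h1 := norm_cusum_le_of_near_right hlk hku hBseg
    have h2 : 2 * B * √((u : ℝ) - k) ≤ 2 * B * √(2 * D) :=
      mul_le_mul_of_nonneg_left (Real.sqrt_le_sqrt h) (by positivity)
    linarith
  obtain ⟨t, htm, htk, hkt⟩ := exists_stretch h0 hlast (show 0 < k by omega) (show k ≤ n by omega)
  have htk' : (v t : ℝ) < k := by exact_mod_cast htk
  have hkt' : (k : ℝ) ≤ v (t + 1) := by exact_mod_cast hkt
  have hnear : |(k : ℝ) - v t| ≤ D ∨ |(k : ℝ) - v (t + 1)| ≤ D := by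
    by_contra! hcon
    obtain ⟨hc1, hc2⟩ := hcon
    rw [abs_of_pos (by linarith)] at hc1
    rw [abs_of_nonpos (by linarith)] at hc2
    have hit : i < t + 1 := lt_of_changePoint_lt hv (by omega) (by
      have : (v i : ℝ) < v (t + 1) := by linarith
      exact_mod_cast this)
    have htj : t < j := lt_of_changePoint_lt hv (by omega) (by
      have : (v t : ℝ) < v j := by linarith
      exact_mod_cast this)
    have hit' : (v i : ℝ) ≤ v t := by exact_mod_cast changePoint_le hv (by omega : i ≤ t) (by omega)
    have htj' : (v (t + 1) : ℝ) ≤ v j := by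
      exact_mod_cast changePoint_le hv (by omega : t + 1 ≤ j) hj
    have hvt : (v t : ℝ) + 2 * L ≤ v (t + 1) := by exact_mod_cast hv t htm
    set p := max l (v t) with hp
    set q := min u (v (t + 1)) with hq
    have hp' : (p : ℝ) = max (l : ℝ) (v t) := by rw [hp]; exact Nat.cast_max ..
    have hq' : (q : ℝ) = min (u : ℝ) (v (t + 1)) := by rw [hq]; exact Nat.cast_min ..
    have hpk : (p : ℝ) + D < k := by
      rw [hp', ← max_add_add_right]
      exact max_lt (by linarith) (by linarith)
    have hkq : (k : ℝ) + D < q := by rw [hq']; exact lt_min (by linarith) (by linarith)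
    have hpD : (p : ℝ) ≤ v t + D := by rw [hp']; exact max_le (by linarith) (by linarith)
    have hqD : (v (t + 1) : ℝ) - D ≤ q := by rw [hq']; exact le_min (by linarith) (by linarith)
    have hmul := near_argmax_mul_le (c := μ t) hM0 (le_max_left l (v t) : l ≤ p)
      (show p < k by have : (p : ℝ) < k := by linarith
                     exact_mod_cast this)
      (show k < q by have : (k : ℝ) < q := by linarith
                     exact_mod_cast this)
      (min_le_left _ _ : q ≤ u)
      (fun s h h' => hY t htm s (by omega) (by omega)) hM hlam (by linarith)
      (by rw [hMdef]; linarith)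
    have hsub : lam * ((u : ℝ) - l) ^ 2 ≤ lam * (n : ℝ) ^ 2 :=
      mul_le_mul_of_nonneg_left (pow_le_pow_left₀ (by linarith) (by linarith) 2) hlam
    -- Both factors are at least D and they sum to q - p, which is at least 2L - 2D and hence at
    -- least L.
    have hprod : D * L / 2 ≤ ((k : ℝ) - p) * (q - k) := by
      have e1 : D * ((q : ℝ) - k) ≤ (k - p) * (q - k) :=
        mul_le_mul_of_nonneg_right (by linarith) (by linarith)
      have e2 : ((k : ℝ) - p) * D ≤ (k - p) * (q - k) :=
        mul_le_mul_of_nonneg_left (by linarith) (by linarith)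
      have e3 : D * L ≤ D * ((q : ℝ) - p) := mul_le_mul_of_nonneg_left (by linarith) (by linarith)
      linarith
    have e4 : M * (D * L / 2) ≤ lam * (n : ℝ) ^ 2 :=
      ((mul_le_mul_of_nonneg_left hprod hM0).trans hmul).trans hsub
    have e5 := mul_le_mul_of_nonneg_right hMlow (show 0 ≤ D * L by positivity)
    have e6 := mul_le_mul_of_nonneg_right e4 (show 0 ≤ 4 * √n by positivity)
    linarith
  obtain ⟨s, hs, hsm⟩ : ∃ s, |(k : ℝ) - v s| ≤ D ∧ s ≤ m + 1 := by
    rcases hnear with h | h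
    · exact ⟨t, h, by omega⟩
    · exact ⟨t + 1, h, by omega⟩
  refine ⟨s, ?_, ?_, hs⟩ <;> rw [abs_le] at hs
  · refine lt_of_changePoint_lt hv (by omega) ?_
    have : (v i : ℝ) < v s := by linarith
    exact_mod_cast this
  · refine lt_of_changePoint_lt hv hsm ?_
    have : (v s : ℝ) < v j := by linarith
    exact_mod_cast this

/-- On the event that the noise is small, every run of binary segmentation finds exactly the change
points inside the segment. -/
theorem BinSeg.exists_matching (h0 : v 0 = 0) (hlast : v (m + 1) = n)
    (hv : ∀ j ≤ m, v j + 2 * L ≤ v (j + 1))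
    (hY : ∀ j ≤ m, ∀ i, v j < i → i ≤ v (j + 1) → Y i = μ j)
    (hB0 : 0 ≤ B) (hμB : ∀ j ≤ m, ‖μ j‖ ≤ B) (hlam : 0 ≤ lam)
    (hE : ∀ l k u, l < k → k < u → u ≤ n → ‖cusum E l u k‖ ≤ lam)
    (hjump : ∀ j < m, η ≤ ‖μ (j + 1) - μ j‖)
    (hD : 1 ≤ D) (hDL : 2 * D ≤ L)
    (hξ : 4 * B * √(2 * D) + lam ≤ ξ) (hbig : 2 * (ξ + 3 * lam) * √n < L * η)
    (hloc : 4 * lam * (n : ℝ) ^ 2 * √n < D * L ^ 2 * η)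
    {l u : ℕ} {V : Finset ℕ} (hV : BinSeg (fun i => Y i + E i) ξ l u V) :
    ∀ {i j : ℕ}, i < j → j ≤ m + 1 → |(l : ℝ) - v i| ≤ D → |(u : ℝ) - v j| ≤ D → u ≤ n →
      ∃ κ : ℕ → ℕ, V = (Finset.Ioo i j).image κ ∧ ∀ t ∈ Finset.Ioo i j, |(κ t : ℝ) - v t| ≤ D := by
  have hB : ∀ i, 0 < i → i ≤ n → ‖Y i‖ ≤ B := fun i hi hin => by
    obtain ⟨t, htm, h1, h2⟩ := exists_stretch h0 hlast hi hin
    rw [hY t htm i h1 h2]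
    exact hμB t htm
  have hempty : ∀ i, Finset.Ioo i (i + 1) = ∅ := fun i => by ext; simp
  induction hV with
  | short l u hlu =>
    intro i j hij hj hl hu hun
    exfalso
    have h1 := changePoint_le hv (show i + 1 ≤ j from hij) hj
    have h2 := hv i (by omega)
    have h3 : (v i : ℝ) + 2 * L ≤ v j := by exact_mod_cast h2.trans h1
    have h4 : (u : ℝ) ≤ l + 1 := by exact_mod_cast hlu
    rw [abs_le] at hl hu
    linarith
  | reject l u k hlu hk hle =>
    intro i j hij hj hl hu hun
    rcases (show i + 1 ≤ j from hij).eq_or_lt with rfl | hij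
    · exact ⟨id, by simp [hempty], by simp [hempty]⟩
    · exact absurd hle (argmax_near_change h0 hlast hv hY hB hB0 hlam hE hjump hD hDL hξ hbig
        hloc hij hj hl hu hun hk).1.not_ge
  | split l u k V₁ V₂ hlu hk hlt _ _ ih₁ ih₂ =>
    intro i j hij hj hl hu hun
    rcases (show i + 1 ≤ j from hij).eq_or_lt with rfl | hij
    · exfalso
      obtain ⟨hlk, hku, -⟩ := hk
      have h1 := norm_cusum_le_of_no_change hv hY hB hμB (by linarith) (by omega : i ≤ m) hl hu hun
        hlk hku
      have h2 := hE l k u hlk hku hun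
      rw [cusum_add] at hlt
      have h3 := norm_add_le (cusum Y l u k) (cusum E l u k)
      linarith
    · obtain ⟨-, t, hit, htj, hkt⟩ := argmax_near_change h0 hlast hv hY hB hB0 hlam hE hjump hD
        hDL hξ hbig hloc hij hj hl hu hun hk
      obtain ⟨κ₁, rfl, hκ₁⟩ := ih₁ hit (by omega) hl hkt (hk.2.1.le.trans hun)
      obtain ⟨κ₂, rfl, hκ₂⟩ := ih₂ htj hj hkt hu hun
      -- The new estimate k is matched with `v t`, and the two recursive matchings are glued on
      -- either side of t.
      refine ⟨fun s => if s < t then κ₁ s else if s = t then k else κ₂ s, ?_, ?_⟩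
      · have hIoo : Finset.Ioo i j = insert t (Finset.Ioo i t ∪ Finset.Ioo t j) := by
          ext s
          simp only [Finset.mem_Ioo, Finset.mem_insert, Finset.mem_union]
          omega
        rw [hIoo, Finset.image_insert, Finset.image_union]
        congr 1
        · simp
        congr 1 <;> refine Finset.image_congr fun s hs => ?_
        · have : s < t := (Finset.mem_Ioo.1 hs).2
          simp [this]
        · have : t < s := (Finset.mem_Ioo.1 hs).1
          simp [this.not_gt, this.ne']
      · intro s hs
        rw [Finset.mem_Ioo] at hs
        rcases lt_trichotomy s t with h | rfl | h
        · simpa [h] using hκ₁ s (Finset.mem_Ioo.2 ⟨hs.1, h⟩)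
        · simpa using hkt
        · simpa [h.not_gt, h.ne'] using hκ₂ s (Finset.mem_Ioo.2 ⟨h, hs.2⟩)

/-- A set matched with well separated change points recovers them in increasing order. -/
theorem recoversWithin_of_matching (hv : ∀ j ≤ m, v j + 2 * L ≤ v (j + 1)) (hD : 1 ≤ D)
    (hDL : 2 * D ≤ L) {V : Finset ℕ} {κ : ℕ → ℕ} (hV : V = (Finset.Ioo 0 (m + 1)).image κ)
    (hκ : ∀ t ∈ Finset.Ioo 0 (m + 1), |(κ t : ℝ) - v t| ≤ D) : RecoversWithin V m v D := by
  have hlt : ∀ a ∈ Finset.Ioo 0 (m + 1), ∀ b ∈ Finset.Ioo 0 (m + 1), a < b → κ a < κ b := by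
    intro a ha b hb hab
    have h1 := abs_le.1 (hκ a ha)
    have h2 := abs_le.1 (hκ b hb)
    rw [Finset.mem_Ioo] at ha hb
    have h3 : v a + 2 * L ≤ v b :=
      (hv a (by omega)).trans (changePoint_le hv (show a + 1 ≤ b from hab) (by omega))
    have h4 : (v a : ℝ) + 2 * L ≤ v b := by exact_mod_cast h3
    have : (κ a : ℝ) < κ b := by linarith
    exact_mod_cast this
  have hinj : Set.InjOn κ (Finset.Ioo 0 (m + 1)) := by
    intro a ha b hb hab
    by_contra hne
    rcases lt_or_gt_of_ne hne with h | h
    · exact (hlt a ha b hb h).ne hab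
    · exact (hlt b hb a ha h).ne' hab
  have hcard : V.card = m := by
    rw [hV, Finset.card_image_of_injOn hinj, Nat.card_Ioo]
    omega
  have hmem : ∀ j : Fin m, (j : ℕ) + 1 ∈ Finset.Ioo 0 (m + 1) := fun j => by
    rw [Finset.mem_Ioo]; omega
  refine ⟨hcard, fun j => ?_⟩
  have huniq := Finset.orderEmbOfFin_unique hcard (f := fun j : Fin m => κ (j + 1))
    (fun j => by rw [hV]; exact Finset.mem_image_of_mem _ (hmem j))
    (fun a b hab => hlt _ (hmem a) _ (hmem b) (by simpa using hab))
  rw [← congrFun huniq j]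
  exact hκ _ (hmem j)

end Recovery

/-! ### A smoothness inequality for `cosh ‖·‖`. -/

section CoshInequality

/-- The power series is ∑ q^k/(2k)!, a nonnegative combination of functions convex on the half-line.
-/
theorem convexOn_cosh_sqrt : ConvexOn ℝ (Set.Ici 0) fun q : ℝ => Real.cosh √q := by
  have hser : ∀ q : ℝ, 0 ≤ q →
      HasSum (fun k : ℕ => q ^ k / ((2 * k).factorial : ℝ)) (Real.cosh √q) := by
    intro q hq
    have h := Real.hasSum_cosh √q
    simpa only [pow_mul, Real.sq_sqrt hq] using h
  refine ⟨convex_Ici 0, fun x hx y hy a b ha hb hab => ?_⟩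
  have hx' : (0 : ℝ) ≤ x := hx
  have hy' : (0 : ℝ) ≤ y := hy
  have hxy : 0 ≤ a • x + b • y := by simp only [smul_eq_mul]; positivity
  refine hasSum_le (fun k => ?_) (hser _ hxy)
    (((hser x hx).mul_left a).add ((hser y hy).mul_left b))
  have := (convexOn_pow (𝕜 := ℝ) k).2 hx hy ha hb hab
  simp only [smul_eq_mul] at this ⊢
  rw [← mul_div_assoc, ← mul_div_assoc, ← add_div]
  exact div_le_div_of_nonneg_right this (Nat.cast_nonneg _)

/-- The radicand is the mixture of (r+y)² and (r-y)² with weights (1±t)/2; convexity and the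
addition formulas do the rest. In use, t is the cosine of the angle between two vectors. -/
theorem cosh_sqrt_le (r y : ℝ) {t : ℝ} (ht : |t| ≤ 1) :
    Real.cosh √(r ^ 2 + y ^ 2 + 2 * t * (r * y)) ≤
      Real.cosh r * Real.cosh y + t * (Real.sinh r * Real.sinh y) := by
  rw [abs_le] at ht
  have h := convexOn_cosh_sqrt.2 (Set.mem_Ici.2 (sq_nonneg (r + y)))
    (Set.mem_Ici.2 (sq_nonneg (r - y)))
    (show 0 ≤ (1 + t) / 2 by linarith) (show 0 ≤ (1 - t) / 2 by linarith) (by ring)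
  simp only [smul_eq_mul, Real.sqrt_sq_eq_abs, Real.cosh_abs, Real.cosh_add, Real.cosh_sub] at h
  refine le_trans (le_of_eq ?_) (h.trans_eq (by ring))
  congr 2
  ring

/-- Every term of the series of e^z - 1 - z has degree at least 2, so scaling by t gains t². With t
= 1/√N this becomes a 1/N gain per summand. -/
theorem exp_mul_sub_le {t y : ℝ} (ht : 0 ≤ t) (ht1 : t ≤ 1) (hy : 0 ≤ y) :
    Real.exp (t * y) - t * y ≤ 1 + t ^ 2 * Real.exp y := by
  have hser : ∀ z : ℝ, HasSum (fun k : ℕ => z ^ (k + 2) / ((k + 2).factorial : ℝ))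
      (Real.exp z - 1 - z) := by
    intro z
    have h := NormedSpace.expSeries_div_hasSum_exp z
    rw [← Real.exp_eq_exp_ℝ, ← hasSum_nat_add_iff' 2] at h
    simpa [Finset.sum_range_succ, sub_sub] using h
  have h := hasSum_le (fun k => ?_) (hser (t * y)) ((hser y).mul_left (t ^ 2))
  · nlinarith [sq_nonneg t]
  · rw [← mul_div_assoc]
    refine div_le_div_of_nonneg_right ?_ (Nat.cast_nonneg _)
    rw [mul_pow, pow_add t]
    have : t ^ k ≤ 1 := pow_le_one₀ ht ht1
    have h2 : 0 ≤ t ^ 2 * y ^ (k + 2) := by positivity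
    nlinarith

variable {H : Type*} [NormedAddCommGroup H] [InnerProductSpace ℝ H]

/-- A second order bound for `cosh ‖·‖` around a point of a Hilbert space. -/
theorem cosh_norm_add_le (s x : H) :
    Real.cosh ‖s + x‖ ≤ Real.cosh ‖s‖ * (Real.exp ‖x‖ - ‖x‖) +
      Real.sinh ‖s‖ / ‖s‖ * inner ℝ s x := by
  have hsinh : ‖x‖ ≤ Real.sinh ‖x‖ := Real.self_le_sinh_iff.2 (norm_nonneg _)
  have hexp := Real.cosh_add_sinh ‖x‖
  -- At s = 0 the coefficient is 0/0 = 0, and the claim reduces to ‖x‖ ≤ sinh ‖x‖.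
  rcases eq_or_ne s 0 with rfl | hs
  · simp only [zero_add, norm_zero, Real.cosh_zero, one_mul, Real.sinh_zero, zero_div, zero_mul,
      add_zero]
    linarith
  rcases eq_or_ne x 0 with rfl | hx
  · simp
  have hs' : 0 < ‖s‖ := norm_pos_iff.2 hs
  have hx' : 0 < ‖x‖ := norm_pos_iff.2 hx
  set t : ℝ := inner ℝ s x / (‖s‖ * ‖x‖) with ht
  have ht1 : |t| ≤ 1 := abs_real_inner_div_norm_mul_norm_le_one s x
  have hinner : inner ℝ s x = t * (‖s‖ * ‖x‖) := by rw [ht]; field_simp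
  have hnorm : ‖s + x‖ = √(‖s‖ ^ 2 + ‖x‖ ^ 2 + 2 * t * (‖s‖ * ‖x‖)) := by
    rw [← Real.sqrt_sq (norm_nonneg (s + x)), norm_add_sq_real, hinner]
    congr 1
    ring
  rw [hnorm]
  refine (cosh_sqrt_le ‖s‖ ‖x‖ ht1).trans ?_
  have e1 : Real.sinh ‖s‖ / ‖s‖ * inner ℝ s x = t * (Real.sinh ‖s‖ * ‖x‖) := by
    rw [hinner]; field_simp
  have hsn : 0 ≤ Real.sinh ‖s‖ := Real.sinh_nonneg_iff.2 hs'.le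
  have e2 : t * (Real.sinh ‖s‖ * (Real.sinh ‖x‖ - ‖x‖)) ≤
      Real.cosh ‖s‖ * (Real.sinh ‖x‖ - ‖x‖) := by
    have h0 : 0 ≤ Real.sinh ‖s‖ * (Real.sinh ‖x‖ - ‖x‖) := mul_nonneg hsn (by linarith)
    refine (mul_le_of_le_one_left h0 (abs_le.1 ht1).2).trans ?_
    exact mul_le_mul_of_nonneg_right (Real.sinh_lt_cosh _).le (by linarith)
  rw [e1, ← hexp]
  linarith

end CoshInequality

/-! ### Exponential tails for sums of independent Hilbert-valued elements. -/

section Tail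

variable {Ω H : Type*} [MeasurableSpace Ω] {P : Measure Ω}
  [NormedAddCommGroup H] [SecondCountableTopology H] [MeasurableSpace H] [BorelSpace H]

theorem integrable_norm_of_exp {X : Ω → H} (hX : Measurable X)
    (hexp : Integrable (fun x => Real.exp ‖X x‖) P) : Integrable X P := by
  refine hexp.mono' hX.aestronglyMeasurable (ae_of_all _ fun x => ?_)
  linarith [Real.add_one_le_exp ‖X x‖]

variable [InnerProductSpace ℝ H] [CompleteSpace H]

/-- The linear term of `cosh_norm_add_le` has mean zero. The lower integral form spares proving
integrability of the left side. -/
theorem lintegral_cosh_norm_const_add_le {X : Ω → H} (hX : Measurable X)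
    (hexp : Integrable (fun x => Real.exp ‖X x‖) P) (hmean : ∫ x, X x ∂P = 0) (s : H) :
    ∫⁻ x, ENNReal.ofReal (Real.cosh ‖s + X x‖) ∂P ≤
      ENNReal.ofReal (Real.cosh ‖s‖) * ENNReal.ofReal (∫ x, (Real.exp ‖X x‖ - ‖X x‖) ∂P) := by
  have hXi := integrable_norm_of_exp hX hexp
  have hin : Integrable (fun x => inner ℝ s (X x)) P := hXi.const_inner s
  have hint : Integrable (fun x => Real.cosh ‖s‖ * (Real.exp ‖X x‖ - ‖X x‖) +
      Real.sinh ‖s‖ / ‖s‖ * inner ℝ s (X x)) P :=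
    ((hexp.sub hXi.norm).const_mul _).add (hin.const_mul _)
  have hval : ∫ x, (Real.cosh ‖s‖ * (Real.exp ‖X x‖ - ‖X x‖) +
      Real.sinh ‖s‖ / ‖s‖ * inner ℝ s (X x)) ∂P =
      Real.cosh ‖s‖ * ∫ x, (Real.exp ‖X x‖ - ‖X x‖) ∂P := by
    have hsub : Integrable (fun x => Real.exp ‖X x‖ - ‖X x‖) P := hexp.sub hXi.norm
    rw [integral_add (hsub.const_mul _) (hin.const_mul _), integral_const_mul,
      integral_const_mul, integral_inner hXi, hmean, inner_zero_right, mul_zero, add_zero]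
  rw [← ENNReal.ofReal_mul (Real.cosh_pos _).le, ← hval, ofReal_integral_eq_lintegral_ofReal hint]
  · exact lintegral_mono fun x => ENNReal.ofReal_le_ofReal (cosh_norm_add_le s (X x))
  · exact ae_of_all _ fun x => (Real.cosh_pos _).le.trans (cosh_norm_add_le s (X x))

variable [IsProbabilityMeasure P]

theorem lintegral_cosh_norm_add_le {S X : Ω → H} (hS : Measurable S) (hX : Measurable X)
    (hind : IndepFun S X P) (hexp : Integrable (fun x => Real.exp ‖X x‖) P)
    (hmean : ∫ x, X x ∂P = 0) :
    ∫⁻ x, ENNReal.ofReal (Real.cosh ‖S x + X x‖) ∂P ≤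
      (∫⁻ x, ENNReal.ofReal (Real.cosh ‖S x‖) ∂P) *
        ENNReal.ofReal (∫ x, (Real.exp ‖X x‖ - ‖X x‖) ∂P) := by
  have hm : Measurable fun p : H × H => ENNReal.ofReal (Real.cosh ‖p.1 + p.2‖) := by
    have : Continuous fun p : H × H => Real.cosh ‖p.1 + p.2‖ := by fun_prop
    exact this.measurable.ennreal_ofReal
  have hm1 : Measurable fun s : H => ENNReal.ofReal (Real.cosh ‖s‖) := by
    have : Continuous fun s : H => Real.cosh ‖s‖ := by fun_prop
    exact this.measurable.ennreal_ofReal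
  have : IsProbabilityMeasure (P.map X) := Measure.isProbabilityMeasure_map hX.aemeasurable
  calc ∫⁻ x, ENNReal.ofReal (Real.cosh ‖S x + X x‖) ∂P
      = ∫⁻ p, ENNReal.ofReal (Real.cosh ‖p.1 + p.2‖) ∂(P.map fun x => (S x, X x)) := by
        rw [lintegral_map hm (hS.prodMk hX)]
    _ = ∫⁻ s, ∫⁻ x, ENNReal.ofReal (Real.cosh ‖s + X x‖) ∂P ∂(P.map S) := by
        rw [hind.map_prod_eq_prod_map_map hS.aemeasurable hX.aemeasurable,
          lintegral_prod _ hm.aemeasurable]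
        refine lintegral_congr fun s => ?_
        exact lintegral_map (hm.comp measurable_prodMk_left) hX
    _ ≤ ∫⁻ s, ENNReal.ofReal (Real.cosh ‖s‖) *
          ENNReal.ofReal (∫ x, (Real.exp ‖X x‖ - ‖X x‖) ∂P) ∂(P.map S) :=
        lintegral_mono fun s => lintegral_cosh_norm_const_add_le hX hexp hmean s
    _ = _ := by rw [lintegral_mul_const _ hm1, lintegral_map hm1 hS]

theorem lintegral_cosh_norm_sum_le {ι : Type*} {f : ι → Ω → H} (hf : ∀ i, Measurable (f i))
    (hind : iIndepFun f P) (hexp : ∀ i, Integrable (fun x => Real.exp ‖f i x‖) P)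
    (hmean : ∀ i, ∫ x, f i x ∂P = 0) {K : ℝ} (hK : ∀ i, ∫ x, (Real.exp ‖f i x‖ - ‖f i x‖) ∂P ≤ K)
    (s : Finset ι) :
    ∫⁻ x, ENNReal.ofReal (Real.cosh ‖∑ i ∈ s, f i x‖) ∂P ≤ ENNReal.ofReal K ^ s.card := by
  classical
  induction s using Finset.induction_on with
  | empty => simp
  | insert i s hi ih =>
    rw [Finset.card_insert_of_notMem hi, pow_succ]
    have h1 : IndepFun (fun x => ∑ j ∈ s, f j x) (f i) P := by
      have := hind.indepFun_finsetSum_of_notMem hf hi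
      simpa only [Finset.sum_fn] using this
    have h2 := lintegral_cosh_norm_add_le (Finset.measurable_fun_sum s fun j _ => hf j) (hf i) h1
      (hexp i) (hmean i)
    simp only [Finset.sum_insert hi]
    simp only [add_comm (f i _)]
    exact h2.trans (mul_le_mul' ih (ENNReal.ofReal_le_ofReal (hK i)))

/-- Exponential tail bound for normalized sums of independent copies of a centered random element
with a finite exponential moment. -/
theorem measure_lt_norm_sum_le {ι : Type*} {f : ι → Ω → H} {g : Ω → H} (hf : ∀ i, Measurable (f i))
    (hind : iIndepFun f P) (hid : ∀ i, IdentDistrib (f i) g P P) {θ : ℝ} (hθ : 0 < θ)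
    (hexp : Integrable (fun x => Real.exp (θ * ‖g x‖)) P) (hmean : ∫ x, g x ∂P = 0)
    (s : Finset ι) (hs : s.Nonempty) (y : ℝ) :
    P {x | √s.card * y < ‖∑ i ∈ s, f i x‖} ≤
      ENNReal.ofReal (2 * Real.exp (∫ x, Real.exp (θ * ‖g x‖) ∂P) * Real.exp (-(θ * y))) := by
  set C := ∫ x, Real.exp (θ * ‖g x‖) ∂P with hC
  have hN : (1 : ℝ) ≤ s.card := by exact_mod_cast hs.card_pos
  have hsN : 1 ≤ √(s.card : ℝ) := by rw [Real.one_le_sqrt]; exact hN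
  -- At this scale each summand contributes a factor at most 1 + C/N, where N = `s.card`, so the
  -- product is at most e^C whatever N is.
  set a : ℝ := θ / √s.card with ha
  have ha0 : 0 < a := by positivity
  set t : ℝ := 1 / √s.card with htdef
  have ht0 : 0 ≤ t := by positivity
  have ht1 : t ≤ 1 := by rw [htdef, div_le_one (by linarith)]; exact hsN
  have hnorm : ∀ i x, ‖a • f i x‖ = t * (θ * ‖f i x‖) := fun i x => by
    rw [norm_smul, Real.norm_of_nonneg ha0.le, ha, htdef]; ring
  have hexpi : ∀ i, Integrable (fun x => Real.exp (θ * ‖f i x‖)) P ∧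
      ∫ x, Real.exp (θ * ‖f i x‖) ∂P = C := fun i => by
    have := (hid i).comp (u := fun z : H => Real.exp (θ * ‖z‖))
      (by have : Continuous fun z : H => Real.exp (θ * ‖z‖) := by fun_prop
          exact this.measurable)
    exact ⟨this.integrable_iff.2 hexp, this.integral_eq⟩
  have hexpa : ∀ i, Integrable (fun x => Real.exp ‖a • f i x‖) P := fun i => by
    refine (hexpi i).1.mono' ?_ (ae_of_all _ fun x => ?_)
    · have : Continuous fun z : H => Real.exp ‖a • z‖ := by fun_prop
      exact (this.measurable.comp (hf i)).aestronglyMeasurable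
    · rw [Real.norm_of_nonneg (Real.exp_pos _).le, hnorm]
      exact Real.exp_le_exp.2 (mul_le_of_le_one_left (by positivity) ht1)
  have hK : ∀ i, ∫ x, (Real.exp ‖a • f i x‖ - ‖a • f i x‖) ∂P ≤ 1 + t ^ 2 * C := fun i => by
    have hni : Integrable (fun x => ‖a • f i x‖) P :=
      (integrable_norm_of_exp ((hf i).const_smul a) (hexpa i)).norm
    rw [← (hexpi i).2]
    calc _ ≤ ∫ x, (1 + t ^ 2 * Real.exp (θ * ‖f i x‖)) ∂P := by
          refine integral_mono ((hexpa i).sub hni)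
            ((integrable_const _).add ((hexpi i).1.const_mul _)) fun x => ?_
          simp only [hnorm]
          exact exp_mul_sub_le ht0 ht1 (by positivity)
      _ = _ := by
          rw [integral_add (integrable_const _) ((hexpi i).1.const_mul _), integral_const_mul]
          simp
  have hind' : iIndepFun (fun i x => a • f i x) P :=
    hind.comp (fun _ z => a • z) fun _ => measurable_const_smul a
  have hL := lintegral_cosh_norm_sum_le (fun i => (hf i).const_smul a) hind' hexpa
    (fun i => by
      simp only [Pi.smul_apply]
      rw [integral_smul, (hid i).integral_eq, hmean, smul_zero]) hK s
  have ht2 : t ^ 2 * s.card = 1 := by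
    rw [htdef, div_pow, Real.sq_sqrt (by linarith)]; field_simp
  have hC0 : 0 ≤ C := integral_nonneg fun x => (Real.exp_pos _).le
  have hpow : ENNReal.ofReal (1 + t ^ 2 * C) ^ s.card ≤ ENNReal.ofReal (Real.exp C) := by
    rw [← ENNReal.ofReal_pow (by positivity)]
    refine ENNReal.ofReal_le_ofReal ?_
    calc (1 + t ^ 2 * C) ^ s.card ≤ Real.exp (t ^ 2 * C) ^ s.card :=
          pow_le_pow_left₀ (by positivity) (by linarith [Real.add_one_le_exp (t ^ 2 * C)]) _
      _ = Real.exp C := by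
          rw [← Real.exp_nat_mul]; congr 1; linear_combination C * ht2
  have hm : Measurable fun x => ENNReal.ofReal (Real.cosh ‖∑ i ∈ s, a • f i x‖) := by
    have h1 : Continuous fun z : H => Real.cosh ‖z‖ := by fun_prop
    exact (h1.measurable.comp (Finset.measurable_fun_sum s
      fun i _ => (hf i).const_smul a)).ennreal_ofReal
  have hmarkov := mul_meas_ge_le_lintegral (μ := P) hm (ENNReal.ofReal (Real.exp (θ * y) / 2))
  have hsub : {x | √s.card * y < ‖∑ i ∈ s, f i x‖} ⊆ {x | ENNReal.ofReal (Real.exp (θ * y) / 2) ≤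
      ENNReal.ofReal (Real.cosh ‖∑ i ∈ s, a • f i x‖)} := by
    intro x hx
    refine ENNReal.ofReal_le_ofReal ?_
    rw [← Finset.smul_sum, norm_smul, Real.norm_of_nonneg ha0.le, Real.cosh_eq]
    have : θ * y ≤ a * ‖∑ i ∈ s, f i x‖ := by
      have h1 : a * (√s.card * y) = θ * y := by rw [ha]; field_simp
      rw [← h1]
      exact mul_le_mul_of_nonneg_left (le_of_lt hx) ha0.le
    have := Real.exp_le_exp.2 this
    have := Real.exp_pos (-(a * ‖∑ i ∈ s, f i x‖))
    linarith
  have hfin := (mul_le_mul' le_rfl (measure_mono hsub)).trans (hmarkov.trans (hL.trans hpow))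
  have hpos : 0 < Real.exp (θ * y) / 2 := by positivity
  rw [mul_comm, ← ENNReal.le_div_iff_mul_le (Or.inl (by simpa using hpos))
      (Or.inl ENNReal.ofReal_ne_top),
    ← ENNReal.ofReal_div_of_pos hpos] at hfin
  refine hfin.trans_eq ?_
  congr 1
  rw [Real.exp_neg]
  field_simp

end Tail

/-! ### Uniform noise bound for the linear process. -/

section Noise

theorem measurable_limUnder_atTop {Ω H : Type*} {m : MeasurableSpace Ω} [NormedAddCommGroup H]
    [CompleteSpace H] [SecondCountableTopology H] [MeasurableSpace H] [BorelSpace H]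
    {f : ℕ → Ω → H} (hf : ∀ N, Measurable (f N)) :
    Measurable (fun x => limUnder atTop (f · x)) :=
  (StronglyMeasurable.limUnder fun N => (hf N).stronglyMeasurable).measurable

/-- Limits of sequences that are measurable for a σ-algebra independent of `X` are independent
of `X`. -/
theorem measurable_and_indepFun_limUnder {Ω H : Type*} {m mΩ : MeasurableSpace Ω} {P : Measure Ω}
    [NormedAddCommGroup H] [CompleteSpace H] [SecondCountableTopology H] [MeasurableSpace H]
    [BorelSpace H] {X : Ω → H} {f : ℕ → Ω → H} (hm : m ≤ mΩ)
    (hind : Indep m (MeasurableSpace.comap X inferInstance) P) (hf : ∀ N, Measurable[m] (f N)) :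
    Measurable (fun x => limUnder atTop (f · x)) ∧
      IndepFun (fun x => limUnder atTop (f · x)) X P := by
  have hZ := measurable_limUnder_atTop hf
  exact ⟨hZ.mono hm le_rfl, indep_of_indep_of_le_left hind hZ.comap_le⟩

variable {Ω H : Type*} [MeasurableSpace Ω] {P : Measure Ω} [IsProbabilityMeasure P]
  [NormedAddCommGroup H] [SecondCountableTopology H] [MeasurableSpace H] [BorelSpace H]

/-- An exponential moment of a sum of independent random elements is inherited by the summands. -/
theorem integrable_exp_norm_of_indep_add {X Z : Ω → H} (hX : Measurable X) (hZ : Measurable Z)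
    (hind : IndepFun Z X P) {θ : ℝ} (hθ : 0 < θ)
    (hexp : Integrable (fun x => Real.exp (θ * ‖X x + Z x‖)) P) :
    Integrable (fun x => Real.exp (θ * ‖X x‖)) P := by
  have hm : Measurable fun p : H × H => ENNReal.ofReal (Real.exp (θ * ‖p.2 + p.1‖)) := by
    have : Continuous fun p : H × H => Real.exp (θ * ‖p.2 + p.1‖) := by fun_prop
    exact this.measurable.ennreal_ofReal
  have : IsProbabilityMeasure (P.map X) := Measure.isProbabilityMeasure_map hX.aemeasurable
  have : IsProbabilityMeasure (P.map Z) := Measure.isProbabilityMeasure_map hZ.aemeasurable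
  have hfin : ∫⁻ z, ∫⁻ x, ENNReal.ofReal (Real.exp (θ * ‖X x + z‖)) ∂P ∂(P.map Z) ≠ ⊤ := by
    have h1 := hexp.lintegral_lt_top.ne
    have h2 : ∫⁻ x, ENNReal.ofReal (Real.exp (θ * ‖X x + Z x‖)) ∂P =
        ∫⁻ p, ENNReal.ofReal (Real.exp (θ * ‖p.2 + p.1‖)) ∂(P.map fun x => (Z x, X x)) := by
      rw [lintegral_map hm (hZ.prodMk hX)]
    rw [h2, hind.map_prod_eq_prod_map_map hZ.aemeasurable hX.aemeasurable,
      lintegral_prod _ hm.aemeasurable] at h1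
    convert h1 using 4 with z
    exact (lintegral_map (hm.comp measurable_prodMk_left) hX).symm
  have hmeas : Measurable fun z => ∫⁻ x, ENNReal.ofReal (Real.exp (θ * ‖X x + z‖)) ∂P := by
    have : Measurable fun p : H × Ω => ENNReal.ofReal (Real.exp (θ * ‖X p.2 + p.1‖)) :=
      hm.comp (measurable_fst.prodMk (hX.comp measurable_snd))
    exact this.lintegral_prod_right'
  -- By Tonelli some fixed shift z has a finite exponential moment; removing it costs only the
  -- factor exp(θ‖z‖).
  obtain ⟨z, hz⟩ := (ae_lt_top hmeas hfin).exists
  have hcont : Continuous fun y : H => Real.exp (θ * ‖y + z‖) := by fun_prop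
  have hcont' : Continuous fun y : H => Real.exp (θ * ‖y‖) := by fun_prop
  have hzint : Integrable (fun x => Real.exp (θ * ‖X x + z‖)) P := by
    refine ⟨(hcont.measurable.comp hX).aestronglyMeasurable, ?_⟩
    rw [hasFiniteIntegral_iff_ofReal (ae_of_all _ fun x => (Real.exp_pos _).le)]
    exact hz
  refine (hzint.const_mul (Real.exp (θ * ‖z‖))).mono'
    (hcont'.measurable.comp hX).aestronglyMeasurable (ae_of_all _ fun x => ?_)
  rw [Real.norm_of_nonneg (Real.exp_pos _).le, ← Real.exp_add, ← mul_add]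
  refine Real.exp_le_exp.2 (mul_le_mul_of_nonneg_left ?_ hθ.le)
  have := norm_sub_le (X x + z) z
  rw [add_sub_cancel_right] at this
  linarith

variable [InnerProductSpace ℝ H] [CompleteSpace H]
  {w : ℤ → Ω → H} {h : ℕ → H →L[ℝ] H} {ε : ℤ → Ω → H}

/-- The innovations of a linear process inherit its exponential moment. -/
theorem IsSubexpLinearProcess.exists_exp_moment_noise (hε : IsSubexpLinearProcess P w h ε) :
    ∃ θ : ℝ, 0 < θ ∧ Integrable (fun x => Real.exp (θ * ‖w 0 x‖)) P := by
  obtain ⟨θ, hθ, hexp⟩ := hε.exp_moment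
  have hwm := hε.noise.measurable
  refine ⟨θ, hθ, ?_⟩
  -- The past part ε₀ - w₀ is only an almost sure limit; `limUnder` supplies a version measurable
  -- for the past σ-algebra, hence independent of w₀.
  let f : ℕ → Ω → H := fun N x => ∑ j ∈ Finset.range N, h (j + 1) (w (0 - ((j + 1 : ℕ) : ℤ)) x)
  have hindep := indep_iSup_of_disjoint (fun i => (hwm i).comap_le) hε.noise.indep
    (show Disjoint (Set.Iio (0 : ℤ)) {0} by simp)
  rw [iSup_singleton] at hindep
  obtain ⟨hZ, hZind⟩ := measurable_and_indepFun_limUnder (f := f)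
    (iSup₂_le fun i _ => (hwm i).comap_le) hindep fun N => by
      refine Finset.measurable_fun_sum _ fun j _ => ?_
      refine (h (j + 1)).continuous.measurable.comp ?_
      refine measurable_iff_comap_le.2 (le_iSup₂_of_le (0 - ((j + 1 : ℕ) : ℤ)) ?_ le_rfl)
      simp only [Set.mem_Iio]
      omega
  refine integrable_exp_norm_of_indep_add (hwm 0) hZ hZind hθ (hexp.congr ?_)
  filter_upwards [hε.hasSum 0] with x hx
  have h1 := (hasSum_nat_add_iff' 1).2 hx
  have h2 : limUnder atTop (f · x) = ε 0 x - w 0 x := by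
    refine h1.tendsto_sum_nat.limUnder_eq.trans ?_
    simp [hε.coeff_zero]
  rw [h2, add_sub_cancel]

/-- Exponential tail bound for sums of innovations along a segment. -/
theorem measure_lt_norm_noise_segment_le (hw : IsStrongWhiteNoise P w) {θ : ℝ} (hθ : 0 < θ)
    (hexp : Integrable (fun x => Real.exp (θ * ‖w 0 x‖)) P) {l k : ℕ} (hlk : l < k) (j : ℕ)
    (y : ℝ) :
    P {x | √((k : ℝ) - l) * y < ‖∑ i ∈ Finset.Ioc l k, w ((i : ℤ) - j) x‖} ≤
      ENNReal.ofReal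
        (2 * Real.exp (∫ x, Real.exp (θ * ‖w 0 x‖) ∂P) * Real.exp (-(θ * y))) := by
  have hinj : Function.Injective fun i : ℕ => (i : ℤ) - j := fun a b hab => by
    simpa using hab
  have := measure_lt_norm_sum_le (fun i : ℕ => hw.measurable ((i : ℤ) - j))
    (hw.indep.precomp hinj) (fun i => hw.identDistrib _) hθ hexp hw.mean_zero
    (Finset.Ioc l k) (Finset.nonempty_Ioc.2 hlk) y
  rwa [Nat.card_Ioc, Nat.cast_sub hlk.le] at this

/-- With probability tending to one, all normalized partial sums of the errors over segments of
`{1, …, n}` are of order at most `n ^ τ`. -/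
theorem IsSubexpLinearProcess.tendsto_measure_large_segmentSum
    (hε : IsSubexpLinearProcess P w h ε) : ∃ C : ℝ, 0 ≤ C ∧ ∀ τ : ℝ, 0 < τ →
      Tendsto (fun n : ℕ => P {x | ¬ ∀ l k : ℕ, l < k → k ≤ n →
        ‖segmentSum (fun i : ℕ => ε i x) l k‖ ≤ √((k : ℝ) - l) * (C * (n : ℝ) ^ τ)})
        atTop (𝓝 0) := by
  obtain ⟨θ, hθ, hexp⟩ := hε.exists_exp_moment_noise
  obtain ⟨a, ρ, ha, hρ0, hρ1, hdecay⟩ := hε.coeff_decay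
  have hsum : Summable fun j : ℕ => a * ρ ^ j * ((j : ℝ) + 1) := by
    have h1 := summable_pow_mul_geometric_of_norm_lt_one (R := ℝ) 1
      (show ‖ρ‖ < 1 by rwa [Real.norm_of_nonneg hρ0.le])
    have h2 := summable_geometric_of_lt_one hρ0.le hρ1
    refine ((h1.add h2).mul_left a).congr fun j => ?_
    ring
  refine ⟨∑' j : ℕ, a * ρ ^ j * ((j : ℝ) + 1), tsum_nonneg fun j => by positivity, fun τ hτ => ?_⟩
  set C := ∑' j : ℕ, a * ρ ^ j * ((j : ℝ) + 1)
  set A := 2 * Real.exp (∫ x, Real.exp (θ * ‖w 0 x‖) ∂P) with hA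
  set q := Real.exp (-θ) with hq
  have hq1 : q < 1 := by rw [hq, Real.exp_lt_one_iff]; linarith
  have hae : ∀ᵐ x ∂P, ∀ i : ℤ, HasSum (fun j : ℕ => h j (w (i - j) x)) (ε i x) :=
    ae_all_iff.2 hε.hasSum
  -- The allowance j + 1 makes the lag probabilities geometrically summable, while the coefficient
  -- decay keeps the weighted sum C finite.
  let bad : ℕ → ℕ × ℕ → ℕ → Set Ω := fun n p j =>
    {x | √((p.2 : ℝ) - p.1) * (((j : ℝ) + 1) * (n : ℝ) ^ τ) <
      ‖∑ i ∈ Finset.Ioc p.1 p.2, w ((i : ℤ) - j) x‖}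
  let I : ℕ → Finset (ℕ × ℕ) := fun n =>
    (Finset.range (n + 1) ×ˢ Finset.range (n + 1)).filter fun p => p.1 < p.2
  have hle : ∀ᶠ n : ℕ in atTop, P {x | ¬ ∀ l k : ℕ, l < k → k ≤ n →
        ‖segmentSum (fun i : ℕ => ε i x) l k‖ ≤ √((k : ℝ) - l) * (C * (n : ℝ) ^ τ)} ≤
      ENNReal.ofReal (((n : ℝ) + 1) ^ 2 * (A * Real.exp (-(θ * (n : ℝ) ^ τ)) * (1 - q)⁻¹)) := by
    filter_upwards [eventually_ge_atTop 1] with n hn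
    have hy : 1 ≤ (n : ℝ) ^ τ := Real.one_le_rpow (by exact_mod_cast hn) hτ.le
    set y := (n : ℝ) ^ τ with hydef
    have hsub : P {x | ¬ ∀ l k : ℕ, l < k → k ≤ n →
        ‖segmentSum (fun i : ℕ => ε i x) l k‖ ≤ √((k : ℝ) - l) * (C * y)} ≤
        P (⋃ p ∈ I n, ⋃ j, bad n p j) := by
      refine measure_mono_ae ?_
      filter_upwards [hae] with x hx hbad
      by_contra hgood
      refine hbad fun l k hlk hkn => ?_
      have hlI : (l, k) ∈ I n := by simp [I]; omega
      have hxj : ∀ j : ℕ, ‖∑ i ∈ Finset.Ioc l k, w ((i : ℤ) - j) x‖ ≤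
          √((k : ℝ) - l) * (((j : ℝ) + 1) * y) := by
        intro j
        by_contra! hj
        exact hgood (Set.mem_biUnion hlI (Set.mem_iUnion.2 ⟨j, hj⟩))
      have hS : HasSum (fun j : ℕ => ∑ i ∈ Finset.Ioc l k, h j (w ((i : ℤ) - j) x))
          (segmentSum (fun i : ℕ => ε i x) l k) := hasSum_sum fun i _ => hx i
      have hG : HasSum (fun j : ℕ => √((k : ℝ) - l) * y * (a * ρ ^ j * ((j : ℝ) + 1)))
          (√((k : ℝ) - l) * y * C) := hsum.hasSum.mul_left _
      refine (hS.norm_le_of_bounded hG fun j => ?_).trans_eq (by ring)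
      rw [← map_sum]
      refine ((h j).le_opNorm _).trans ?_
      refine (mul_le_mul (hdecay j).le (hxj j) (norm_nonneg _) (by positivity)).trans_eq (by ring)
    refine hsub.trans ((measure_biUnion_finset_le _ _).trans ?_)
    have hone : ∀ p ∈ I n, P (⋃ j, bad n p j) ≤
        ENNReal.ofReal (A * Real.exp (-(θ * y)) * (1 - q)⁻¹) := by
      intro p hp
      have hp' : p.1 < p.2 := (Finset.mem_filter.1 hp).2
      have hgeo : HasSum (fun j : ℕ => A * Real.exp (-(θ * y)) * q ^ j)
          (A * Real.exp (-(θ * y)) * (1 - q)⁻¹) :=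
        (hasSum_geometric_of_lt_one (Real.exp_pos _).le hq1).mul_left _
      rw [← hgeo.tsum_eq, ENNReal.ofReal_tsum_of_nonneg (fun j => by positivity) hgeo.summable]
      refine (measure_iUnion_le _).trans (ENNReal.tsum_le_tsum fun j => ?_)
      refine (measure_lt_norm_noise_segment_le hε.noise hθ hexp hp' j _).trans
        (ENNReal.ofReal_le_ofReal ?_)
      rw [mul_assoc A, hq, ← Real.exp_nat_mul, ← Real.exp_add]
      refine mul_le_mul_of_nonneg_left (Real.exp_le_exp.2 ?_) (by positivity)
      have : (j : ℝ) * θ ≤ j * θ * y := le_mul_of_one_le_right (by positivity) hy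
      linarith
    refine (Finset.sum_le_sum hone).trans ?_
    rw [Finset.sum_const, nsmul_eq_mul, ENNReal.ofReal_mul (p := ((n : ℝ) + 1) ^ 2) (by positivity)]
    have hcard : ((I n).card : ENNReal) ≤ ENNReal.ofReal (((n : ℝ) + 1) ^ 2) := by
      rw [← ENNReal.ofReal_natCast]
      refine ENNReal.ofReal_le_ofReal ?_
      have : (I n).card ≤ (n + 1) ^ 2 :=
        (Finset.card_filter_le _ _).trans_eq (by rw [Finset.card_product, Finset.card_range, sq])
      exact_mod_cast this
    gcongr
  refine tendsto_of_tendsto_of_tendsto_of_le_of_le' tendsto_const_nhds ?_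
    (Eventually.of_forall fun _ => bot_le) hle
  rw [← ENNReal.ofReal_zero]
  refine ENNReal.tendsto_ofReal ?_
  -- The first factor is n², the order of the number of segments.
  have hlim : Tendsto (fun n : ℕ => ((n : ℝ) ^ τ) ^ (2 / τ) * Real.exp (-θ * (n : ℝ) ^ τ)) atTop
      (𝓝 0) :=
    (tendsto_rpow_mul_exp_neg_mul_atTop_nhds_zero (2 / τ) θ hθ).comp
      ((tendsto_rpow_atTop hτ).comp tendsto_natCast_atTop_atTop)
  have hlim' := hlim.const_mul (4 * (A * (1 - q)⁻¹))
  rw [mul_zero] at hlim'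
  have hq0 : 0 < 1 - q := by linarith
  refine squeeze_zero' (Eventually.of_forall fun n => by positivity) ?_ hlim'
  filter_upwards [eventually_ge_atTop 1] with n hn
  have hn' : (1 : ℝ) ≤ n := by exact_mod_cast hn
  rw [← Real.rpow_mul (by positivity), mul_div_cancel₀ _ hτ.ne', Real.rpow_two, neg_mul]
  have h4 : ((n : ℝ) + 1) ^ 2 ≤ 4 * (n : ℝ) ^ 2 := by nlinarith
  calc _ ≤ 4 * (n : ℝ) ^ 2 * (A * Real.exp (-(θ * (n : ℝ) ^ τ)) * (1 - q)⁻¹) :=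
        mul_le_mul_of_nonneg_right h4 (by positivity)
    _ = _ := by ring

end Noise

/-! ### Comparison of the rates. -/

section Rates

theorem eventually_const_mul_rpow_lt {a b : ℝ} (hab : a < b) (C : ℝ) :
    ∀ᶠ n : ℕ in atTop, C * (n : ℝ) ^ a < (n : ℝ) ^ b := by
  have h1 : Tendsto (fun n : ℕ => (n : ℝ) ^ (b - a)) atTop atTop :=
    (tendsto_rpow_atTop (by linarith)).comp tendsto_natCast_atTop_atTop
  filter_upwards [h1.eventually_gt_atTop C, eventually_ge_atTop 1] with n hn hn1
  have hn0 : (0 : ℝ) < n := by exact_mod_cast hn1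
  calc C * (n : ℝ) ^ a < (n : ℝ) ^ (b - a) * (n : ℝ) ^ a :=
        mul_lt_mul_of_pos_right hn (by positivity)
    _ = (n : ℝ) ^ b := by rw [← Real.rpow_add hn0, sub_add_cancel]

theorem eventually_log_le_rpow {a : ℝ} (ha : 0 < a) :
    ∀ᶠ n : ℕ in atTop, 1 ≤ Real.log n ∧ Real.log n ≤ (n : ℝ) ^ a := by
  have h1 := (isLittleO_log_rpow_atTop ha).bound (show (0 : ℝ) < 1 by norm_num)
  have h2 := Real.tendsto_log_atTop.eventually_ge_atTop 1
  filter_upwards [tendsto_natCast_atTop_atTop.eventually h1,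
    tendsto_natCast_atTop_atTop.eventually h2] with n hn hn1
  refine ⟨hn1, ?_⟩
  rw [one_mul, Real.norm_of_nonneg (by linarith),
    Real.norm_of_nonneg (Real.rpow_nonneg (Nat.cast_nonneg _) _)] at hn
  exact hn

/-- The rates of the theorem meet the requirements of the deterministic recovery result, for noise
of order `n ^ ((1 / 8 - ω) / 2)`. -/
theorem eventually_rates {ω e η c₁ B C : ℝ} (hω₀ : 0 ≤ ω) (hω : ω < 1 / 8) (he₀ : 0 < e)
    (hη : 0 < η) (hc₁ : 0 < c₁) (hB : 0 ≤ B) :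
    ∀ᶠ n : ℕ in atTop, ∀ ξ D lam : ℝ, ∀ L : ℕ,
      (n : ℝ) ^ (3 / 8 + e) < ξ → ξ < (n : ℝ) ^ (1 / 2 - ω - e) →
      D = (n : ℝ) ^ (5 / 8 + ω) * Real.log n → lam = C * (n : ℝ) ^ ((1 / 8 - ω) / 2) →
      L = ⌊c₁ / 2 * (n : ℝ) ^ (1 - ω)⌋₊ →
      1 ≤ D ∧ 2 * D ≤ L ∧ 4 * B * √(2 * D) + lam ≤ ξ ∧ 2 * (ξ + 3 * lam) * √n < L * η ∧
        4 * lam * (n : ℝ) ^ 2 * √n < D * L ^ 2 * η := by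
  set τ := (1 / 8 - ω) / 2 with hτ
  have hτ0 : 0 < τ := by linarith
  -- Half of `c₁ / 2` is given up to absorb the floor in L.
  set c := c₁ / 4 with hc
  have hc0 : 0 < c := by positivity
  filter_upwards [eventually_log_le_rpow hτ0, eventually_ge_atTop 1,
    eventually_const_mul_rpow_lt (show (0 : ℝ) < 1 - ω by linarith) (1 / c),
    eventually_const_mul_rpow_lt (show 5 / 8 + ω + τ < 1 - ω by linarith) (2 / c),
    eventually_const_mul_rpow_lt (show (5 / 8 + ω + τ) / 2 < 3 / 8 + e by linarith) (16 * B),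
    eventually_const_mul_rpow_lt (show τ < 3 / 8 + e by linarith) (2 * C),
    eventually_const_mul_rpow_lt (show 1 - ω - e < 1 - ω by linarith) (4 / (c * η)),
    eventually_const_mul_rpow_lt (show τ + 1 / 2 < 1 - ω by linarith) (12 * C / (c * η)),
    -- This is τ < 1/8 - ω, the localization requirement that governs the choice of τ.
    eventually_const_mul_rpow_lt (show τ + 5 / 2 < 5 / 8 + ω + (1 - ω) * 2 by linarith)
      (4 * C / (c ^ 2 * η))]
    with n hlog hn h1 h2 h3 h4 h5 h6 h7 ξ D lam L hξ1 hξ2 hD hlam hL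
  have hn1 : (1 : ℝ) ≤ n := by exact_mod_cast hn
  have hn0 : (0 : ℝ) < n := by linarith
  have hLlow : c * (n : ℝ) ^ (1 - ω) ≤ L := by
    rw [div_mul_eq_mul_div, Real.rpow_zero, mul_one, div_lt_iff₀ hc0] at h1
    have := Nat.lt_floor_add_one (c₁ / 2 * (n : ℝ) ^ (1 - ω))
    rw [← hL] at this
    rw [hc] at h1 ⊢
    linarith
  have hL0 : (0 : ℝ) ≤ L := Nat.cast_nonneg _
  have hDlow : (n : ℝ) ^ (5 / 8 + ω) ≤ D := by
    rw [hD]; exact le_mul_of_one_le_right (by positivity) hlog.1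
  have hDup : D ≤ (n : ℝ) ^ (5 / 8 + ω + τ) := by
    rw [hD, Real.rpow_add hn0 _ τ]
    exact mul_le_mul_of_nonneg_left hlog.2 (by positivity)
  have hD1 : 1 ≤ D := (Real.one_le_rpow hn1 (by linarith)).trans hDlow
  have hsqrt : √(n : ℝ) = (n : ℝ) ^ (1 / 2 : ℝ) := Real.sqrt_eq_rpow _
  refine ⟨hD1, ?_, ?_, ?_, ?_⟩
  · rw [div_mul_eq_mul_div, div_lt_iff₀ hc0] at h2
    linarith
  · have hs : √(2 * D) ≤ 2 * (n : ℝ) ^ ((5 / 8 + ω + τ) / 2) := by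
      refine Real.sqrt_le_iff.2 ⟨by positivity, ?_⟩
      rw [mul_pow, ← Real.rpow_natCast, ← Real.rpow_natCast _ 2, ← Real.rpow_mul hn0.le]
      norm_num
      have : 0 < (n : ℝ) ^ (5 / 8 + ω + τ) := by positivity
      linarith
    have := mul_le_mul_of_nonneg_left hs (show 0 ≤ 4 * B by positivity)
    rw [hlam]
    linarith
  · rw [div_mul_eq_mul_div, div_lt_iff₀ (by positivity)] at h5 h6
    have e1 : ξ * √n ≤ (n : ℝ) ^ (1 - ω - e) := by
      refine (mul_le_mul_of_nonneg_right hξ2.le (Real.sqrt_nonneg _)).trans_eq ?_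
      rw [hsqrt, ← Real.rpow_add hn0]; congr 1; ring
    have e2 : lam * √n = C * (n : ℝ) ^ (τ + 1 / 2) := by
      rw [hsqrt, hlam, mul_assoc, ← Real.rpow_add hn0]
    have e3 := mul_le_mul_of_nonneg_right hLlow hη.le
    nlinarith
  · rw [div_mul_eq_mul_div, div_lt_iff₀ (by positivity)] at h7
    have e1 : 4 * lam * (n : ℝ) ^ 2 * √n = 4 * C * (n : ℝ) ^ (τ + 5 / 2) := by
      rw [hsqrt, hlam, ← Real.rpow_natCast, show τ + 5 / 2 = τ + (2 : ℕ) + 1 / 2 by push_cast; ring,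
        Real.rpow_add hn0, Real.rpow_add hn0]
      ring
    have e2 : (n : ℝ) ^ (5 / 8 + ω + (1 - ω) * 2) * (c ^ 2 * η) =
        (n : ℝ) ^ (5 / 8 + ω) * (c * (n : ℝ) ^ (1 - ω)) ^ 2 * η := by
      rw [Real.rpow_add hn0, Real.rpow_mul hn0.le, Real.rpow_two]
      ring
    rw [e1]
    refine h7.trans_le ?_
    rw [e2]
    refine mul_le_mul_of_nonneg_right ?_ hη.le
    exact mul_le_mul hDlow (pow_le_pow_left₀ (by positivity) hLlow 2) (by positivity) (by linarith)

end Rates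

/-! ### The consistency theorem. -/

theorem theorem1 {Ω H : Type*} [MeasurableSpace Ω] (P : Measure Ω) [IsProbabilityMeasure P]
    [NormedAddCommGroup H] [InnerProductSpace ℝ H] [CompleteSpace H]
    [TopologicalSpace.SeparableSpace H] [MeasurableSpace H] [BorelSpace H]
    (w : ℤ → Ω → H) (h : ℕ → H →L[ℝ] H) (ε : ℤ → Ω → H)
    (hε : IsSubexpLinearProcess P w h ε)
    (m : ℕ → ℕ) (v : ℕ → ℕ → ℕ) (μ : ℕ → ℕ → H) (X : ℕ → ℕ → Ω → H)
    (hX : ∀ᶠ n in atTop, IsChangePointModel n (m n) (v n) (μ n) ε (X n))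
    (η : ℝ) (hη : 0 < η)
    (hjump : ∀ᶠ n in atTop, ∀ j < m n, η < ‖μ n (j + 1) - μ n j‖)
    (c₁ ω : ℝ) (hc₁ : 0 < c₁) (hω₀ : 0 ≤ ω) (hω : ω < 1 / 8)
    (hdist : ∀ᶠ n : ℕ in atTop, ∀ j ≤ m n,
      c₁ * (n : ℝ) ^ (1 - ω) ≤ (v n (j + 1) : ℝ) - (v n j : ℝ))
    (B : ℝ) (hmean : ∀ᶠ n in atTop, ∀ j ≤ m n, ‖μ n j‖ < B)
    (e : ℝ) (he₀ : 0 < e) (he : e < 1 / 8 - ω)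
    (ξ : ℕ → ℝ)
    (hξ : ∀ᶠ n : ℕ in atTop,
      (n : ℝ) ^ (3 / 8 + e) < ξ n ∧ ξ n < (n : ℝ) ^ (1 / 2 - ω - e))
    -- the segmentation may be started at index `0` or at index `1`
    (s : ℕ) (hs : s = 0 ∨ s = 1) :
    Tendsto (fun n : ℕ => P {x | ∀ V : Finset ℕ,
        BinSeg (fun i => X n i x) (ξ n) s n V →
          RecoversWithin V (m n) (v n) ((n : ℝ) ^ (5 / 8 + ω) * Real.log n)})
      atTop (𝓝 1) := by
  have : SecondCountableTopology H := UniformSpace.secondCountable_of_separable H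
  have hB : 0 ≤ B := by
    obtain ⟨n, hn⟩ := hmean.exists
    exact (norm_nonneg _).trans (hn 0 (Nat.zero_le _)).le
  obtain ⟨C, hC, htend⟩ := hε.tendsto_measure_large_segmentSum
  set τ := (1 / 8 - ω) / 2 with hτ
  have hlim := htend τ (by linarith)
  have hlow := ENNReal.Tendsto.sub (tendsto_const_nhds (x := (1 : ENNReal)) (f := atTop)) hlim
    (Or.inl ENNReal.one_ne_top)
  rw [tsub_zero] at hlow
  refine tendsto_of_tendsto_of_tendsto_of_le_of_le' hlow tendsto_const_nhds ?_
    (Eventually.of_forall fun _ => prob_le_one)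
  filter_upwards [hX, hjump, hdist, hmean, hξ, eventually_ge_atTop 1,
    eventually_rates hω₀ hω he₀ hη hc₁ hB (C := 2 * C)]
    with n hX hjump hdist hmean hξ hn hrates
  set D := (n : ℝ) ^ (5 / 8 + ω) * Real.log n with hD
  set L := ⌊c₁ / 2 * (n : ℝ) ^ (1 - ω)⌋₊ with hL
  set lam := 2 * C * (n : ℝ) ^ τ with hlam
  obtain ⟨hD1, hDL, hr1, hr2, hr3⟩ := hrates (ξ n) D lam L hξ.1 hξ.2 hD hlam hL
  have hv : ∀ j ≤ m n, v n j + 2 * L ≤ v n (j + 1) := fun j hj => by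
    have h1 := hdist j hj
    have h2 : (L : ℝ) ≤ c₁ / 2 * (n : ℝ) ^ (1 - ω) := Nat.floor_le (by positivity)
    have : (v n j : ℝ) + 2 * L ≤ v n (j + 1) := by linarith
    exact_mod_cast this
  rw [tsub_le_iff_right, ← measure_univ (μ := P)]
  -- Subadditivity over success and large noise avoids any measurability question for the success
  -- event.
  refine (measure_mono fun x _ => ?_).trans (measure_union_le _ _)
  rw [Set.mem_union, or_iff_not_imp_right]
  intro hx V hV
  have hgood : ∀ l k : ℕ, l < k → k ≤ n →
      ‖segmentSum (fun i : ℕ => ε i x) l k‖ ≤ √((k : ℝ) - l) * (C * (n : ℝ) ^ τ) := by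
    by_contra hcon
    exact hx hcon
  have hE : ∀ l k u, l < k → k < u → u ≤ n → ‖cusum (fun i : ℕ => ε i x) l u k‖ ≤ lam :=
    fun l k u hlk hku hun =>
      (norm_cusum_le _ hlk hku (hgood l k hlk (hku.le.trans hun)) (hgood k u hku hun)).trans_eq
        (by rw [hlam]; ring)
  have hV' : BinSeg (fun i => (X n i x - ε i x) + ε i x) (ξ n) s n V := by
    simpa only [sub_add_cancel] using hV
  obtain ⟨κ, hκV, hκ⟩ := hV'.exists_matching hX.first hX.last hv
    (fun j hj i h1 h2 => by rw [hX.obs j hj i h1 h2 x, add_sub_cancel_right]) hB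
    (fun j hj => (hmean j hj).le) (by positivity) hE (fun j hj => (hjump j hj).le) hD1 hDL hr1 hr2
    hr3 (Nat.succ_pos (m n)) le_rfl
    -- Starting at index 1 is an endpoint error of 1, covered by D ≥ 1.
    (by rw [hX.first]; rcases hs with rfl | rfl <;> simp <;> linarith)
    (by rw [hX.last, sub_self, abs_zero]; linarith) le_rfl
  exact recoversWithin_of_matching hv hD1 hDL hκV hκ
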